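/- All graphs are finite and simple. $N(v)$ is the set of neighbors of $v$, and $N[v]=N(v)\cup\{v\}$. A \emph{diamond} is $K_4$ minus one edge. Merging non-adjacent vertices replaces them by one vertex whose neighborhood is the union of their neighborhoods. Consider two reduction rules for a $K_4$-free graph: (R1) if $u_1,u_2,u_3,u_4$ induce a diamond with $u_1u_2\notin E$, merge $u_1$ and $u_2$; (R2) if $u\neq v$ and $N(u)\subseteq N(v)$, remove $u$. A graph is \emph{irreducible} if it is $K_4$-free and neither rule applies to it. The set $N[v]$ is an \emph{articulation neighborhood} of $G$ if $G-N[v]$ is disconnected. \textbf{Algorithm 1.} Input: a graph $G$ and a vertex $v_0$. \begin{enumerate} \item Compute the connected components of $G-N[v_0]$. If some component is not bipartite, return ``$G$ is not 3-colorable''. Otherwise, for each component, merge each of its two color classes into one vertex. Call the resulting graph $G'$. \item While $G'$ contains no $K_4$ and one of R1, R2 applies to $G'$, apply one of them to $G'$. (If $v_0$ is merged with another vertex, the new vertex is called $v_0$; if $v_0$ is removed because $N(v_0)\subseteq N(v)$, then $v$ is called $v_0$ from then on.) If $G'$ contains a $K_4$ at the end, return ``$G$ is not 3-colorable''. \item In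 $G'$, let $N_0$ be the set of the vertices of $N(v_0)$ that have no neighbor in $N(v_0)$, and let $N_1=N(v_0)\setminus N_0=\{z_1,\dots,z_{2q}\}$ with $z_{2j-1}z_{2j}\in E'$. Color $v_0$ red. If $G'-N[v_0]$ is empty, color $N(v_0)$ properly with blue and green. Otherwise let $\{u_i,w_i\}$, $1\le i\le k$, be the connected components of $G'-N[v_0]$, and color $N_0$ green. \begin{itemize} \item If $N_1=\emptyset$, color every $u_i$ blue and every $w_i$ red. \item If $N_1\ne\emptyset$, let $\phi$ be the 2SAT formula in variables $x_1,\dots,x_k,y_1,\dots,y_q$ with the following clauses, for all $i,j$: $(x_i\vee\overline{y_j})$ if $u_iz_{2j-1}\in E'$ and $(x_i\vee y_j)$ otherwise; $(\overline{x_i}\vee\overline{y_j})$ if $w_iz_{2j-1}\in E'$ and $(\overline{x_i}\vee y_j)$ otherwise. If $\phi$ is unsatisfiable, return ``$G$ is not 3-colorable''. Otherwise take a satisfying assignment. If $x_i=1$, color $u_i$ red and $w_i$ blue, else color $u_i$ blue and $w_i$ red. If $y_j=1$, color $z_{2j-1}$ blue and $z_{2j}$ green, else color $z_{2j-1}$ green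 and $z_{2j}$ blue. \end{itemize} \item Undo all mergings and removals: merged vertices receive the color of the vertex that they were merged into, and a vertex $u$ that was removed because of $N(u)\subseteq N(v)$ receives the color of $v$. Return the resulting coloring of $G$. \end{enumerate} \textbf{Theorem.} Algorithm 1 decides 3-coloring in polynomial time on irreducible graphs of diameter 2 with an articulation neighborhood. That is, there are a program $P$ for a unit-cost random access machine (with addition and truncated subtraction as its arithmetic) and a polynomial $p$ such that, for every irreducible graph $G$ with $n$ vertices and $\mathrm{diam}(G)=2$, and every vertex $v_0$ of $G$ such that $G-N[v_0]$ is disconnected, the following holds. However the choices that Algorithm 1 leaves open are made, its run on $(G,v_0)$ never gets stuck and ends after at most $p(n)$ transitions (a transition being the merging of the color classes, one application of a rule, or a step that returns an output). Every output that it can return is correct: it is either a proper 3-coloring of $G$, or the announcement that $G$ is not 3-colorable for a graph that is indeed not 3-colorable. And $P$, given $n$, $v_0$ and the adjacency matrix of $G$, halts after at most $p(n)$ elementary steps with an output that Algorithm 1 can return on $(G,v_0)$. -/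

import Mathlib

namespace ThreeCol

/-! ### Graph notions -/

section Graphs

variable {V : Type*}

/-- The vertices `a, b, c, d` induce a diamond in `H`, where `a b` is the missing edge. -/
def IsDiamond (H : SimpleGraph V) (a b c d : V) : Prop :=
  a ≠ b ∧ ¬ H.Adj a b ∧ H.Adj a c ∧ H.Adj a d ∧ H.Adj b c ∧ H.Adj b d ∧ H.Adj c d

/-- `u` and `v` are distinct vertices with `N(u) ⊆ N(v)` (so they are non-adjacent, and siblings). -/
def IsSibling (H : SimpleGraph V) (u v : V) : Prop :=
  u ≠ v ∧ H.neighborSet u ⊆ H.neighborSet v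

/-- `G` is `K₄`-free, and neither the diamond elimination nor the siblings elimination applies. -/
def IsIrreducible (G : SimpleGraph V) : Prop :=
  G.CliqueFree 4 ∧ (¬ ∃ a b c d, IsDiamond G a b c d) ∧ ¬ ∃ u v, IsSibling G u v

/-- The closed neighborhood `N[v]`. -/
def closedNbhd (G : SimpleGraph V) (v : V) : Set V := insert v (G.neighborSet v)

/-- The graph `G - N[v]`. -/
abbrev outside (G : SimpleGraph V) (v : V) : SimpleGraph ↥(closedNbhd G v)ᶜ :=
  G.induce (closedNbhd G v)ᶜ

/-- `N[v]` is an articulation neighborhood of `G`: the graph `G - N[v]` is disconnected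
(the empty graph does not count as disconnected). -/
def IsArticulationNbhd (G : SimpleGraph V) (v : V) : Prop := ¬ (outside G v).Preconnected

/-- The three colors. -/
inductive Color
  | red
  | blue
  | green
  deriving DecidableEq

end Graphs

/-! ### The algorithm, as a transition system

Every choice that the pseudocode leaves open (the names of the merged vertices, which reduction is
applied next, the enumerations, the satisfying assignment) is a nondeterministic choice here. -/

section Algorithm

variable {V : Type*}

/-- The current reduced graph: its vertex set, its edges (all of them between vertices in `verts`),
the vertex that plays the role of `v₀`, and, for every vertex of the input graph, the current
vertex whose color it will receive when all mergings and removals are undone. -/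
structure State (V : Type*) where
  verts : Set V
  graph : SimpleGraph V
  root : V
  rep : V → V

/-- `m` merges each of the two color classes (under the 2-coloring `c`) of each connected component
of `G - N[v₀]` into one of its vertices, and does nothing else. -/
def IsMerging (G : SimpleGraph V) (v₀ : V) (c : (outside G v₀).Coloring Bool) (m : V → V) : Prop :=
  (∀ x ∈ closedNbhd G v₀, m x = x) ∧
  (∀ x : ↥(closedNbhd G v₀)ᶜ, ∃ y : ↥(closedNbhd G v₀)ᶜ,
    m x = y ∧ (outside G v₀).Reachable x y ∧ c x = c y) ∧
  ∀ x y : ↥(closedNbhd G v₀)ᶜ, (outside G v₀).Reachable x y → c x = c y → m x = m y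

/-- The state after the color classes have been merged along `m`. Here `G.map m` joins two distinct
vertices if they are the images of two adjacent vertices. -/
def mergedState (G : SimpleGraph V) (v₀ : V) (m : V → V) : State V where
  verts := Set.range m
  graph := G.map m
  root := v₀
  rep := m

/-- The function that sends `u` to `v` and fixes everything else. -/
noncomputable def redirect (u v : V) : V → V :=
  open Classical in fun x => if x = u then v else x

/-- Merge `u` into `v` (the new vertex, with neighborhood `N(u) ∪ N(v)`, is named `v`). -/
noncomputable def State.mergeInto (s : State V) (u v : V) : State V where
  verts := s.verts \ {u}
  graph := s.graph.map (redirect u v)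
  root := redirect u v s.root
  rep := redirect u v ∘ s.rep

/-- Remove `u`, which is later colored like `v`; if `u` plays the role of `v₀`, then `v` takes over
that role. -/
noncomputable def State.removeFor (s : State V) (u v : V) : State V where
  verts := s.verts \ {u}
  graph := s.graph.deleteIncidenceSet u
  root := redirect u v s.root
  rep := redirect u v ∘ s.rep

/-- One application of one of the two reduction rules. -/
inductive Reduce : State V → State V → Prop
  | diamond (s : State V) (a b c d : V) (h : IsDiamond s.graph a b c d) :
      Reduce s (s.mergeInto a b)
  | siblings (s : State V) (u v : V) (hu : u ∈ s.verts) (hv : v ∈ s.verts)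
      (h : IsSibling s.graph u v) : Reduce s (s.removeFor u v)

/-- The neighborhood of `v₀` in the current graph. -/
def State.nbhd (s : State V) : Set V := s.graph.neighborSet s.root

/-- The vertices of `N(v₀)` without a neighbor in `N(v₀)`. -/
def State.isolated (s : State V) : Set V := {w ∈ s.nbhd | ∀ a ∈ s.nbhd, ¬ s.graph.Adj w a}

/-- The other vertices of `N(v₀)`. -/
def State.paired (s : State V) : Set V := s.nbhd \ s.isolated

/-- The vertices of the current graph outside `N[v₀]`. -/
def State.rest (s : State V) : Set V := s.verts \ closedNbhd s.graph s.root

/-- The connected components of the current graph minus `N[v₀]` are `{u i, w i}`, each listed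
once, where `u i ≠ w i`. -/
def ListsComponents (s : State V) {k : ℕ} (u w : Fin k → V) : Prop :=
  (∀ i, u i ≠ w i) ∧
  ∃ e : Fin k ≃ (s.graph.induce s.rest).ConnectedComponent,
    ∀ i, Subtype.val '' (e i).supp = {u i, w i}

/-- The paired vertices are `z 0, z' 0, z 1, z' 1, …`, each listed once, with `z j` adjacent to
`z' j`. -/
def ListsPairs (s : State V) {q : ℕ} (z z' : Fin q → V) : Prop :=
  (∀ j, s.graph.Adj (z j) (z' j)) ∧ Function.Injective (Sum.elim z z') ∧
  Set.range (Sum.elim z z') = s.paired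

/-- A literal: a variable with its sign (`true` for the variable, `false` for its negation). -/
abbrev Literal (α : Type*) := α × Bool

/-- A 2-CNF formula: a set of clauses with two literals each. -/
abbrev TwoCNF (α : Type*) := Set (Literal α × Literal α)

/-- The assignment `τ` satisfies the formula `φ`. -/
def Satisfies {α : Type*} (τ : α → Bool) (φ : TwoCNF α) : Prop :=
  ∀ C ∈ φ, τ C.1.1 = C.1.2 ∨ τ C.2.1 = C.2.2

/-- The formula in the variables `x i` (here `Sum.inl i`) and `y j` (here `Sum.inr j`): for all
`i, j` it has the clause `x i ∨ ¬ y j` if `u i` is adjacent to `z j`, and `x i ∨ y j` if not; and the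
clause `¬ x i ∨ ¬ y j` if `w i` is adjacent to `z j`, and `¬ x i ∨ y j` if not. -/
noncomputable def formula (s : State V) {k q : ℕ} (u w : Fin k → V) (z : Fin q → V) :
    TwoCNF (Fin k ⊕ Fin q) :=
  open Classical in
  {C | ∃ i j,
    C = ((Sum.inl i, true), (Sum.inr j, if s.graph.Adj (u i) (z j) then false else true)) ∨
    C = ((Sum.inl i, false), (Sum.inr j, if s.graph.Adj (w i) (z j) then false else true))}

/-- The part of the algorithm after the reductions: either it announces that there is no 3-coloring
(`none`), or it computes a coloring of the current graph (only the colors of the vertices in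
`verts` matter). -/
inductive Finish (s : State V) : Option (V → Color) → Prop
  /-- There are no vertices outside `N[v₀]`: 2-color `N(v₀)`. -/
  | noRest (χ : V → Color) (hR : s.rest = ∅) (hroot : χ s.root = .red)
      (hN : ∀ a ∈ s.nbhd, χ a = .blue ∨ χ a = .green)
      (hproper : ∀ a ∈ s.nbhd, ∀ b ∈ s.nbhd, s.graph.Adj a b → χ a ≠ χ b) :
      Finish s (some χ)
  /-- There are no paired vertices. -/
  | noPairs (χ : V → Color) {k : ℕ} (u w : Fin k → V) (hR : s.rest ≠ ∅)
      (hC : ListsComponents s u w) (hP : s.paired = ∅) (hroot : χ s.root = .red)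
      (hN : ∀ a ∈ s.nbhd, χ a = .green)
      (huw : ∀ i, χ (u i) = .blue ∧ χ (w i) = .red) :
      Finish s (some χ)
  /-- The 2-CNF formula is not satisfiable. -/
  | unsat {k q : ℕ} (u w : Fin k → V) (z z' : Fin q → V) (hR : s.rest ≠ ∅)
      (hC : ListsComponents s u w) (hP : s.paired ≠ ∅) (hZ : ListsPairs s z z')
      (hφ : ¬ ∃ τ, Satisfies τ (formula s u w z)) :
      Finish s none
  /-- The coloring is read off from a satisfying assignment `τ`. -/
  | sat (χ : V → Color) {k q : ℕ} (u w : Fin k → V) (z z' : Fin q → V) (hR : s.rest ≠ ∅)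
      (hC : ListsComponents s u w) (hP : s.paired ≠ ∅) (hZ : ListsPairs s z z')
      (τ : Fin k ⊕ Fin q → Bool) (hτ : Satisfies τ (formula s u w z))
      (hroot : χ s.root = .red) (hN : ∀ a ∈ s.isolated, χ a = .green)
      (huw : ∀ i, if τ (Sum.inl i) = true
        then χ (u i) = .red ∧ χ (w i) = .blue else χ (u i) = .blue ∧ χ (w i) = .red)
      (hz : ∀ j, if τ (Sum.inr j) = true
        then χ (z j) = .blue ∧ χ (z' j) = .green else χ (z j) = .green ∧ χ (z' j) = .blue) :
      Finish s (some χ)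

/-- The configurations of the algorithm: before the merging of the components, inside the
reduction loop, and halted with an output (`none`: the announcement that the input graph is not
3-colorable; `some χ`: the coloring `χ` of the input graph). -/
inductive Config (V : Type*)
  | start
  | loop (s : State V)
  | halted (out : Option (V → Color))

/-- The transitions of the algorithm on the input `G`, `v₀`. -/
inductive Step (G : SimpleGraph V) (v₀ : V) : Config V → Config V → Prop
  /-- Some component of `G - N[v₀]` is not bipartite. -/
  | notBipartite (C : (outside G v₀).ConnectedComponent) (hC : ¬ C.toSimpleGraph.IsBipartite) :
      Step G v₀ .start (.halted none)
  /-- All components are bipartite; merge their color classes. -/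
  | merge (c : (outside G v₀).Coloring Bool) (m : V → V) (hm : IsMerging G v₀ c m) :
      Step G v₀ .start (.loop (mergedState G v₀ m))
  /-- Apply a reduction rule, as long as there is no `K₄`. -/
  | reduce (s s' : State V) (hK : s.graph.CliqueFree 4) (h : Reduce s s') :
      Step G v₀ (.loop s) (.loop s')
  /-- A `K₄` was found. -/
  | clique (s : State V) (hK : ¬ s.graph.CliqueFree 4) : Step G v₀ (.loop s) (.halted none)
  /-- No rule applies any more; color the current graph, and undo the mergings and removals. -/
  | finish (s : State V) (hK : s.graph.CliqueFree 4) (hs : ¬ ∃ s', Reduce s s')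
      (out : Option (V → Color)) (h : Finish s out) :
      Step G v₀ (.loop s) (.halted (out.map fun χ => χ ∘ s.rep))

/-- `c` can be reached in a run of the algorithm on the input `G`, `v₀`. -/
def Reached (G : SimpleGraph V) (v₀ : V) (c : Config V) : Prop :=
  Relation.ReflTransGen (Step G v₀) .start c

/-- The output is correct: a proper 3-coloring of `G`, or the announcement that `G` is not
3-colorable for a graph that is not 3-colorable. -/
def IsCorrect (G : SimpleGraph V) : Option (V → Color) → Prop
  | none => ¬ G.Colorable 3
  | some χ => ∀ a b, G.Adj a b → χ a ≠ χ b

end Algorithm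

/-! ### Random access machine

A structured programming language for a unit-cost random access machine. A program is a finite text;
its memory consists of registers `reg x` and two-dimensional arrays `arr a i j` that hold natural
numbers. The arithmetic is addition and truncated subtraction (no multiplication), so that in `t`
steps the bit lengths of the stored numbers grow by at most `t`. -/

section Machine

/-- The memory. -/
structure Memory where
  reg : ℕ → ℕ
  arr : ℕ → ℕ → ℕ → ℕ

/-- Expressions. -/
inductive Expr
  | const (c : ℕ)
  | reg (x : ℕ)
  | arr (a : ℕ) (i j : Expr)
  | add (e f : Expr)
  | sub (e f : Expr)
  | lt (e f : Expr)
  | eq (e f : Expr)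

/-- The value of an expression; comparisons give `1` or `0`. -/
def Expr.eval (m : Memory) : Expr → ℕ
  | .const c => c
  | .reg x => m.reg x
  | .arr a i j => m.arr a (i.eval m) (j.eval m)
  | .add e f => e.eval m + f.eval m
  | .sub e f => e.eval m - f.eval m
  | .lt e f => if e.eval m < f.eval m then 1 else 0
  | .eq e f => if e.eval m = f.eval m then 1 else 0

/-- The number of steps that the evaluation of an expression takes: one for each node. -/
def Expr.cost : Expr → ℕ
  | .const _ => 1
  | .reg _ => 1
  | .arr _ i j => i.cost + j.cost + 1
  | .add e f => e.cost + f.cost + 1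
  | .sub e f => e.cost + f.cost + 1
  | .lt e f => e.cost + f.cost + 1
  | .eq e f => e.cost + f.cost + 1

/-- Programs. -/
inductive Program
  | skip
  | assign (x : ℕ) (e : Expr)
  | store (a : ℕ) (i j e : Expr)
  | seq (P Q : Program)
  | ite (e : Expr) (P Q : Program)
  | loop (e : Expr) (P : Program)

/-- Write the value `v` into the register `x`. -/
def Memory.setReg (m : Memory) (x v : ℕ) : Memory :=
  { m with reg := fun y => if y = x then v else m.reg y }

/-- Write the value `v` into the cell `(i, j)` of the array `a`. -/
def Memory.setArr (m : Memory) (a i j v : ℕ) : Memory :=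
  { m with arr := fun b k l => if b = a ∧ k = i ∧ l = j then v else m.arr b k l }

/-- `Exec P m m' t`: started with the memory `m`, the program `P` halts after `t` steps with the
memory `m'`. (`ite` and `loop` test whether an expression is nonzero; `loop` is a while loop.) -/
inductive Exec : Program → Memory → Memory → ℕ → Prop
  | skip (m : Memory) : Exec .skip m m 1
  | assign (m : Memory) (x : ℕ) (e : Expr) :
      Exec (.assign x e) m (m.setReg x (e.eval m)) (e.cost + 1)
  | store (m : Memory) (a : ℕ) (i j e : Expr) :
      Exec (.store a i j e) m (m.setArr a (i.eval m) (j.eval m) (e.eval m))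
        (i.cost + j.cost + e.cost + 1)
  | seq {P Q : Program} {m₁ m₂ m₃ : Memory} {t₁ t₂ : ℕ} (h₁ : Exec P m₁ m₂ t₁)
      (h₂ : Exec Q m₂ m₃ t₂) : Exec (.seq P Q) m₁ m₃ (t₁ + t₂)
  | iteTrue {e : Expr} {P Q : Program} {m m' : Memory} {t : ℕ} (he : e.eval m ≠ 0)
      (h : Exec P m m' t) : Exec (.ite e P Q) m m' (e.cost + 1 + t)
  | iteFalse {e : Expr} {P Q : Program} {m m' : Memory} {t : ℕ} (he : e.eval m = 0)
      (h : Exec Q m m' t) : Exec (.ite e P Q) m m' (e.cost + 1 + t)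
  | loopTrue {e : Expr} {P : Program} {m₁ m₂ m₃ : Memory} {t₁ t₂ : ℕ} (he : e.eval m₁ ≠ 0)
      (h₁ : Exec P m₁ m₂ t₁) (h₂ : Exec (.loop e P) m₂ m₃ t₂) :
      Exec (.loop e P) m₁ m₃ (e.cost + 1 + t₁ + t₂)
  | loopFalse {e : Expr} {P : Program} {m : Memory} (he : e.eval m = 0) :
      Exec (.loop e P) m m (e.cost + 1)

/-- The initial memory for the input `G`, `v₀`: register `0` holds `n`, register `1` holds `v₀`,
array `0` holds the adjacency matrix of `G`, and everything else is `0`. -/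
noncomputable def inputMemory {n : ℕ} (G : SimpleGraph (Fin n)) (v₀ : Fin n) : Memory where
  reg := fun x => if x = 0 then n else if x = 1 then (v₀ : ℕ) else 0
  arr := open Classical in fun a i j =>
    if a = 0 ∧ ∃ u v : Fin n, (u : ℕ) = i ∧ (v : ℕ) = j ∧ G.Adj u v then 1 else 0

/-- The number that stands for a color. -/
def Color.code : Color → ℕ
  | .red => 0
  | .blue => 1
  | .green => 2

/-- The final memory shows the output: register `0` holds `0` for the announcement that the graph
is not 3-colorable; for a coloring it holds `1`, and the color of the vertex `v` is in the cell
`(v, 0)` of array `1`. -/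
def Shows {n : ℕ} (m : Memory) : Option (Fin n → Color) → Prop
  | none => m.reg 0 = 0
  | some χ => m.reg 0 = 1 ∧ ∀ v : Fin n, m.arr 1 v 0 = (χ v).code

end Machine

end ThreeCol

/-! Suppose `G` has a 3-coloring, with `v₀` red. By diameter 2, two vertices in different components
of `G - N[v₀]` have a common neighbor; it lies in `N(v₀)`, hence is not red, so one of the two
vertices cannot be blue while the other is green. If blue and green both occurred outside `N[v₀]`,
they would share a component, and every other component would be entirely red, hence a single vertex
`y` with `N(y) ⊆ N(v₀)`, contrary to irreducibility. So, up to swapping blue and green, `G - N[v₀]`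
is colored red and blue (`exists_red_blue_coloring`). In particular its components are bipartite,
and merging their color classes respects this coloring.

The merging and both rules are images under vertex maps that separate adjacent vertices. Four
properties survive all of them (`State.Invariant`): `G` maps homomorphically to the current graph,
distances are at most 2, a 3-colorable `G` yields a coloring with a red root and only red and blue
outside its closed neighborhood, and a vertex of `rest` with two neighbors in `rest` sees an edge
inside the neighborhood of the root (`State.Thin`). When no rule applies and there is no `K₄`, an
edge has at most one common neighbor. It follows that `rest` and `paired` induce perfect matchings,
and that each vertex of `rest` is adjacent to exactly one end of each paired edge
(`adj_iff_not_adj`). A blue vertex of `rest` therefore dictates the colors of all pairs, which is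
what the 2SAT clauses express.

The machine program is written as first-order updates of relations with `n`-fold iteration, compiled
to polynomial time. It needs no 2SAT solver: one blue vertex `p` of `rest` fixes the colors of all
pairs, so it is enough to try every `p`. For a negative answer it suffices that `G` is not
3-colorable: some run halts, and its correct output can only be that announcement. -/

namespace ThreeCol

/-! ### Compiling first-order updates and iterations into polynomial-time programs -/

section Compiler

/-- A family of binary relations on the vertices, indexed by the natural numbers. -/
abbrev Rels (n : ℕ) := ℕ → Fin n → Fin n → Prop

/-- First-order formulas over a family of binary relations and the order of the vertices. The
variables are de Bruijn levels. -/
inductive Fml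
  | eq (x y : ℕ)
  | lt (x y : ℕ)
  | rel (a x y : ℕ)
  | not (φ : Fml)
  | and (φ ψ : Fml)
  | ex (φ : Fml)

namespace Fml

/-- The meaning of a formula with the free variables `0, …, k - 1`. -/
def Holds {n : ℕ} (S : Rels n) : Fml → ℕ → (ℕ → Fin n) → Prop
  | eq x y, _, ρ => ρ x = ρ y
  | lt x y, _, ρ => ρ x < ρ y
  | rel a x y, _, ρ => S a (ρ x) (ρ y)
  | not φ, k, ρ => ¬ φ.Holds S k ρ
  | and φ ψ, k, ρ => φ.Holds S k ρ ∧ ψ.Holds S k ρ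
  | ex φ, k, ρ => ∃ v, φ.Holds S (k + 1) (Function.update ρ k v)

/-- The free variables are below `k`, and the relation `1` does not occur. -/
def Scoped : Fml → ℕ → Bool
  | eq x y, k => x < k && y < k
  | lt x y, k => x < k && y < k
  | rel a x y, k => a != 1 && x < k && y < k
  | not φ, k => φ.Scoped k
  | and φ ψ, k => φ.Scoped k && ψ.Scoped k
  | ex φ, k => φ.Scoped (k + 1)

/-- Disjunction. -/
def or (φ ψ : Fml) : Fml := not (and (not φ) (not ψ))

/-- Implication. -/
def imp (φ ψ : Fml) : Fml := not (and φ (not ψ))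

/-- Universal quantification. -/
def all (φ : Fml) : Fml := not (ex (not φ))

theorem holds_or {n : ℕ} (S : Rels n) (φ ψ : Fml) (k : ℕ) (ρ : ℕ → Fin n) :
    (φ.or ψ).Holds S k ρ ↔ φ.Holds S k ρ ∨ ψ.Holds S k ρ := by
  simp only [or, Holds]; tauto

theorem holds_imp {n : ℕ} (S : Rels n) (φ ψ : Fml) (k : ℕ) (ρ : ℕ → Fin n) :
    (φ.imp ψ).Holds S k ρ ↔ (φ.Holds S k ρ → ψ.Holds S k ρ) := by
  simp only [imp, Holds]; tauto

theorem holds_all {n : ℕ} (S : Rels n) (φ : Fml) (k : ℕ) (ρ : ℕ → Fin n) :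
    φ.all.Holds S k ρ ↔ ∀ v, φ.Holds S (k + 1) (Function.update ρ k v) := by
  simp only [all, Holds]; push Not; rfl

end Fml

/-- Run the program for the values `0, …, n - 1` of the register `r`, where register `0` holds
`n`. -/
def forLoop (r : ℕ) (P : Program) : Program :=
  .seq (.assign r (.const 0))
    (.loop (.lt (.reg r) (.reg 0)) (.seq P (.assign r (.add (.reg r) (.const 1)))))

theorem Memory.setReg_reg (m : Memory) (x v y : ℕ) :
    (m.setReg x v).reg y = if y = x then v else m.reg y := rfl

/-- The rule for `forLoop` with an invariant. -/
theorem exec_forLoop {n r T : ℕ} {P : Program} (hr : r ≠ 0) (I : ℕ → Memory → Prop)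
    (hI : ∀ i < n, ∀ m, I i m → m.reg 0 = n → m.reg r = i →
      ∃ m' t, Exec P m m' t ∧ t ≤ T ∧ m'.reg 0 = n ∧ m'.reg r = i ∧
        I (i + 1) (m'.setReg r (i + 1)))
    (m : Memory) (h0 : m.reg 0 = n) (hm : I 0 (m.setReg r 0)) :
    ∃ m' t, Exec (forLoop r P) m m' t ∧ t ≤ (T + 8) * n + 6 ∧ m'.reg 0 = n ∧ I n m' := by
  -- Besides its body, a pass pays 4 for the test and 4 for the increment; the final failing test
  -- costs 4 and the initialization 2.
  have key : ∀ d i m, i + d = n → I i m → m.reg 0 = n → m.reg r = i →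
      ∃ m' t, Exec (.loop (.lt (.reg r) (.reg 0))
        (.seq P (.assign r (.add (.reg r) (.const 1))))) m m' t ∧
        t ≤ (T + 8) * d + 4 ∧ m'.reg 0 = n ∧ I n m' := by
    intro d
    induction d with
    | zero =>
      intro i m hi hIm h0 hk
      refine ⟨m, _, Exec.loopFalse ?_, ?_, h0, ?_⟩
      · simp [Expr.eval, h0, hk]; omega
      · simp [Expr.cost]
      · have : i = n := by omega
        exact this ▸ hIm
    | succ d ih =>
      intro i m hi hIm h0 hk
      obtain ⟨m₁, t₁, h₁, ht₁, h01, hk1, hI1⟩ := hI i (by omega) m hIm h0 hk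
      obtain ⟨m₂, t₂, h₂, ht₂, h02, hI2⟩ := ih (i + 1) (m₁.setReg r (i + 1)) (by omega) hI1
        (by simp [Memory.setReg_reg, h01, hr.symm]) (by simp [Memory.setReg_reg])
      have ha := Exec.assign m₁ r (.add (.reg r) (.const 1))
      have he : (Expr.add (.reg r) (.const 1)).eval m₁ = i + 1 := by
        simp [Expr.eval, hk1]
      rw [he] at ha
      refine ⟨m₂, _, Exec.loopTrue ?_ (Exec.seq h₁ ha) h₂, ?_, h02, hI2⟩
      · simp [Expr.eval, h0, hk]; omega
      · simp only [Expr.cost]; rw [mul_add]; omega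
  obtain ⟨m', t, h, ht, h0', hI'⟩ := key n 0 (m.setReg r 0) (by omega) hm
    (by simp [Memory.setReg_reg, h0, hr.symm]) (by simp [Memory.setReg_reg])
  refine ⟨m', _, Exec.seq (Exec.assign m _ _) h, ?_, h0', hI'⟩
  simp only [Expr.cost]; omega

/-- The memories agree on the arrays and on the registers up to `2 * k`. -/
def Memory.Agree (k : ℕ) (m m' : Memory) : Prop :=
  m'.arr = m.arr ∧ ∀ x ≤ 2 * k, m'.reg x = m.reg x

theorem Memory.Agree.setReg {k x : ℕ} {m m' : Memory} (h : m.Agree k m') (hx : 2 * k < x) (v : ℕ) :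
    m.Agree k (m'.setReg x v) := by
  refine ⟨h.1, fun y hy => ?_⟩
  rw [Memory.setReg_reg, if_neg (by omega), h.2 y hy]

theorem Memory.Agree.trans {k l : ℕ} {m m' m'' : Memory} (h : m.Agree k m') (h' : m'.Agree l m'')
    (hkl : k ≤ l) : m.Agree k m'' :=
  ⟨h'.1.trans h.1, fun x hx => (h'.2 x (by omega)).trans (h.2 x hx)⟩

theorem Memory.Agree.refl (k : ℕ) (m : Memory) : m.Agree k m := ⟨rfl, fun _ _ => rfl⟩

/-- The memory holds the values of the variables below `k` and the relations except `1`. -/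
structure Holding {n : ℕ} (S : Rels n) (k : ℕ) (ρ : ℕ → Fin n) (m : Memory) : Prop where
  size : m.reg 0 = n
  var : ∀ x < k, m.reg (2 * x + 1) = ρ x
  arr : ∀ a ≠ 1, ∀ i j : Fin n, m.arr a i j ≠ 0 ↔ S a i j

theorem Holding.agree {n : ℕ} {S : Rels n} {k : ℕ} {ρ : ℕ → Fin n} {m m' : Memory}
    (h : Holding S k ρ m) (h' : m.Agree k m') : Holding S k ρ m' where
  size := (h'.2 0 (by omega)).trans h.size
  var x hx := (h'.2 _ (by omega)).trans (h.var x hx)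
  arr a ha i j := by rw [h'.1]; exact h.arr a ha i j

theorem Holding.update {n : ℕ} {S : Rels n} {k : ℕ} {ρ : ℕ → Fin n} {m : Memory}
    (h : Holding S k ρ m) (v : Fin n) (hv : m.reg (2 * k + 1) = v) :
    Holding S (k + 1) (Function.update ρ k v) m where
  size := h.size
  var x hx := by
    rcases Nat.lt_succ_iff_lt_or_eq.1 hx with hx | rfl
    · rw [Function.update_of_ne hx.ne]; exact h.var x hx
    · rw [Function.update_self]; exact hv
  arr := h.arr

namespace Fml

/-- A program that computes whether a formula with the free variables `0, …, k - 1` holds; the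
register `2 * k + 2` receives a nonzero number if this is the case, and `0` otherwise. -/
def code : Fml → ℕ → Program
  | eq x y, k => .assign (2 * k + 2) (.eq (.reg (2 * x + 1)) (.reg (2 * y + 1)))
  | lt x y, k => .assign (2 * k + 2) (.lt (.reg (2 * x + 1)) (.reg (2 * y + 1)))
  | rel a x y, k => .assign (2 * k + 2) (.arr a (.reg (2 * x + 1)) (.reg (2 * y + 1)))
  | not φ, k => .seq (φ.code k) (.assign (2 * k + 2) (.sub (.const 1) (.reg (2 * k + 2))))
  | and φ ψ, k => .seq (φ.code k) (.ite (.reg (2 * k + 2)) (ψ.code k) .skip)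
  | ex φ, k => .seq (.assign (2 * k + 2) (.const 0)) (forLoop (2 * k + 1) (.seq (φ.code (k + 1))
      (.assign (2 * k + 2) (.add (.reg (2 * k + 2)) (.reg (2 * (k + 1) + 2))))))

/-- A bound for the running time of `Fml.code`. -/
noncomputable def time : Fml → Polynomial ℕ
  | eq _ _ => 4
  | lt _ _ => 4
  | rel _ _ _ => 4
  | not φ => φ.time + 4
  | and φ ψ => φ.time + ψ.time + 3
  | ex φ => (φ.time + 12) * Polynomial.X + 8

/-- Variable `x` lives in register `2 * x + 1`, and the answer of level `k` in register `2 * k + 2`.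
Evaluation at level `k` writes only above register `2 * k`, so the variables and the pending answers
of the outer levels survive. -/
theorem exec_code {n : ℕ} (S : Rels n) (φ : Fml) (k : ℕ) (ρ : ℕ → Fin n) (m : Memory)
    (hs : φ.Scoped k) (hm : Holding S k ρ m) :
    ∃ m' t, Exec (φ.code k) m m' t ∧ t ≤ φ.time.eval n ∧ m.Agree k m' ∧
      (m'.reg (2 * k + 2) ≠ 0 ↔ φ.Holds S k ρ) := by
  induction φ generalizing k ρ m with
  | eq x y =>
    simp only [Scoped, Bool.and_eq_true, decide_eq_true_eq] at hs
    refine ⟨_, _, Exec.assign _ _ _, by simp [Expr.cost, time],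
      (Memory.Agree.refl k m).setReg (by omega) _, ?_⟩
    simp [Memory.setReg_reg, Expr.eval, hm.var x hs.1, hm.var y hs.2, Holds, Fin.ext_iff]
  | lt x y =>
    simp only [Scoped, Bool.and_eq_true, decide_eq_true_eq] at hs
    refine ⟨_, _, Exec.assign _ _ _, by simp [Expr.cost, time],
      (Memory.Agree.refl k m).setReg (by omega) _, ?_⟩
    simp [Memory.setReg_reg, Expr.eval, hm.var x hs.1, hm.var y hs.2, Holds]
  | rel a x y =>
    simp only [Scoped, Bool.and_eq_true, decide_eq_true_eq, bne_iff_ne] at hs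
    refine ⟨_, _, Exec.assign _ _ _, by simp [Expr.cost, time],
      (Memory.Agree.refl k m).setReg (by omega) _, ?_⟩
    simpa [Memory.setReg_reg, Expr.eval, hm.var x hs.1.2, hm.var y hs.2, Holds]
      using hm.arr a hs.1.1 (ρ x) (ρ y)
  | not φ ih =>
    obtain ⟨m', t, h, ht, ha, hr⟩ := ih k ρ m hs hm
    refine ⟨_, _, Exec.seq h (Exec.assign _ _ _), ?_, ha.setReg (by omega) _, ?_⟩
    · simp only [Expr.cost, time, Polynomial.eval_add, Polynomial.eval_ofNat]; omega
    · simp only [Memory.setReg_reg, Expr.eval, Holds, ← hr, if_true]; omega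
  | and φ ψ ih₁ ih₂ =>
    simp only [Scoped, Bool.and_eq_true] at hs
    obtain ⟨m', t, h, ht, ha, hr⟩ := ih₁ k ρ m hs.1 hm
    by_cases h0 : m'.reg (2 * k + 2) = 0
    · refine ⟨_, _, Exec.seq h (Exec.iteFalse h0 (Exec.skip _)), ?_, ha, ?_⟩
      · simp only [Expr.cost, time, Polynomial.eval_add, Polynomial.eval_ofNat]; omega
      · simp only [Holds, ← hr]; tauto
    · obtain ⟨m'', t', h', ht', ha', hr'⟩ := ih₂ k ρ m' hs.2 (hm.agree ha)
      refine ⟨_, _, Exec.seq h (Exec.iteTrue h0 h'), ?_, ha.trans ha' le_rfl, ?_⟩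
      · simp only [Expr.cost, time, Polynomial.eval_add, Polynomial.eval_ofNat]; omega
      · simp only [Holds, ← hr, ← hr']; tauto
  | ex φ ih =>
    simp only [Scoped] at hs
    set m₀ := m.setReg (2 * k + 2) 0 with hm₀
    have hag : m.Agree k m₀ := (Memory.Agree.refl k m).setReg (by omega) _
    obtain ⟨m', t, h, ht, -, hag', hr⟩ := exec_forLoop (n := n) (r := 2 * k + 1) (by omega)
      (P := .seq (φ.code (k + 1))
        (.assign (2 * k + 2) (.add (.reg (2 * k + 2)) (.reg (2 * (k + 1) + 2)))))
      (T := φ.time.eval n + 4)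
      -- Register `2 * k + 2` accumulates the sum of the answers, which is nonzero exactly when some
      -- witness has been met.
      (fun i m' => m.Agree k m' ∧ (m'.reg (2 * k + 2) ≠ 0 ↔
        ∃ v : Fin n, v < i ∧ φ.Holds S (k + 1) (Function.update ρ k v)))
      (by
        rintro i hi m₁ ⟨hag₁, hr₁⟩ h0 hk
        obtain ⟨m₂, t₂, h₂, ht₂, hag₂, hr₂⟩ := ih (k + 1) (Function.update ρ k ⟨i, hi⟩) m₁ hs
          ((hm.agree hag₁).update _ hk)
        refine ⟨_, _, Exec.seq h₂ (Exec.assign _ _ _), ?_, ?_, ?_,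
          ((hag₁.trans hag₂ (by omega)).setReg (by omega) _).setReg (by omega) _, ?_⟩
        · simp only [Expr.cost]; omega
        · rw [Memory.setReg_reg, if_neg (by omega), hag₂.2 _ (by omega), h0]
        · rw [Memory.setReg_reg, if_neg (by omega), hag₂.2 _ (by omega), hk]
        · rw [Memory.setReg_reg, if_neg (by omega), Memory.setReg_reg, if_pos rfl]
          simp only [Expr.eval]
          rw [hag₂.2 (2 * k + 2) (by omega)]
          have : m₁.reg (2 * k + 2) + m₂.reg (2 * (k + 1) + 2) ≠ 0 ↔
            m₁.reg (2 * k + 2) ≠ 0 ∨ m₂.reg (2 * (k + 1) + 2) ≠ 0 := by omega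
          rw [this, hr₁, hr₂]
          constructor
          · rintro (⟨v, hv, h⟩ | h)
            · exact ⟨v, by omega, h⟩
            · exact ⟨⟨i, hi⟩, by simp, h⟩
          · rintro ⟨v, hv, h⟩
            by_cases hvi : (v : ℕ) < i
            · exact Or.inl ⟨v, hvi, h⟩
            · have : v = ⟨i, hi⟩ := Fin.ext (by simp; omega)
              exact Or.inr (this ▸ h))
      m₀ (by simp [hm₀, Memory.setReg_reg, hm.size])
      ⟨hag.setReg (by omega) _, by simp [hm₀, Memory.setReg_reg]⟩
    refine ⟨m', _, Exec.seq (Exec.assign _ _ _) h, ?_, hag', ?_⟩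
    · simp only [Expr.cost, time, Polynomial.eval_add, Polynomial.eval_mul, Polynomial.eval_X,
        Polynomial.eval_ofNat]
      have : (φ.time.eval n + 4 + 8) * n = (φ.time.eval n + 12) * n := by ring
      omega
    · rw [hr]; simp [Holds]

end Fml

/-- A loop in which the `i`-th pass establishes `D i`, while `F` and all `D j` are preserved. -/
theorem exec_forLoop_all {n r T : ℕ} {P : Program} (hr : r ≠ 0) (F : Memory → Prop)
    (D : Fin n → Memory → Prop) (hF : ∀ m v, F m → F (m.setReg r v))
    (hD : ∀ i m v, D i m → D i (m.setReg r v)) (hF0 : ∀ m, F m → m.reg 0 = n)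
    (hP : ∀ (i : Fin n) m, F m → m.reg r = i →
      ∃ m' t, Exec P m m' t ∧ t ≤ T ∧ m'.reg r = i ∧ F m' ∧ D i m' ∧ ∀ j, D j m → D j m')
    (m : Memory) (hm : F m) :
    ∃ m' t, Exec (forLoop r P) m m' t ∧ t ≤ (T + 8) * n + 6 ∧ F m' ∧ (∀ i, D i m') ∧
      ∀ j, D j m → D j m' := by
  obtain ⟨m', t, h, ht, -, hF', hD', hp⟩ := exec_forLoop (n := n) (P := P) (T := T) hr
    (fun i m' => F m' ∧ (∀ j : Fin n, j < i → D j m') ∧ ∀ j, D j m → D j m')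
    (by
      rintro i hi m₁ ⟨h₁, h₂, h₃⟩ h0 hk
      obtain ⟨m₂, t, h, ht, hk₂, hF₂, hD₂, hp⟩ := hP ⟨i, hi⟩ m₁ h₁ hk
      refine ⟨m₂, t, h, ht, hF0 _ hF₂, hk₂, hF _ _ hF₂, fun j hj => hD _ _ _ ?_,
        fun j hj => hD _ _ _ (hp _ (h₃ j hj))⟩
      by_cases hji : (j : ℕ) < i
      · exact hp _ (h₂ j hji)
      · have : j = ⟨i, hi⟩ := Fin.ext (by simp; omega)
        exact this ▸ hD₂)
    m (hF0 m hm) ⟨hF _ _ hm, fun j hj => absurd hj (by omega), fun j hj => hD _ _ _ hj⟩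
  exact ⟨m', t, h, ht, hF', fun i => hD' i i.2, hp⟩

/-- Two nested loops. -/
theorem exec_forLoop_forLoop_all {n r r' T : ℕ} {P : Program} (hr : r ≠ 0) (hr' : r' ≠ 0)
    (hrr : r ≠ r') (F : Memory → Prop) (D : Fin n → Fin n → Memory → Prop)
    (hF : ∀ m x v, x = r ∨ x = r' → F m → F (m.setReg x v))
    (hD : ∀ i j m x v, D i j m → D i j (m.setReg x v))
    (hF0 : ∀ m, F m → m.reg 0 = n)
    (hP : ∀ (i j : Fin n) m, F m → m.reg r = i → m.reg r' = j →
      ∃ m' t, Exec P m m' t ∧ t ≤ T ∧ m'.reg r = i ∧ m'.reg r' = j ∧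
        F m' ∧ D i j m' ∧ ∀ i' j', D i' j' m → D i' j' m')
    (m : Memory) (hm : F m) :
    ∃ m' t, Exec (forLoop r (forLoop r' P)) m m' t ∧ t ≤ (((T + 8) * n + 6) + 8) * n + 6 ∧
      F m' ∧ ∀ i j, D i j m' := by
  obtain ⟨m', t, h, ht, hF', hD', -⟩ := exec_forLoop_all (n := n)
    (P := forLoop r' P) (T := (T + 8) * n + 6) hr F (fun i m => ∀ j, D i j m)
    (fun m v h => hF m _ v (Or.inl rfl) h) (fun i m v h j => hD i j m _ v (h j)) hF0
    (by
      intro i m hm hi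
      obtain ⟨m', t, h, ht, ⟨hF', hi', hp⟩, hD', -⟩ := exec_forLoop_all (n := n)
        (P := P) (T := T) hr'
        (fun m' => F m' ∧ m'.reg r = i ∧ ∀ i' j', D i' j' m → D i' j' m')
        (fun j m => D i j m)
        (fun m v h => ⟨hF m _ v (Or.inr rfl) h.1,
          by rw [Memory.setReg_reg, if_neg hrr, h.2.1],
          fun i' j' h' => hD _ _ _ _ _ (h.2.2 i' j' h')⟩)
        (fun j m v h => hD i j m _ v h) (fun m h => hF0 m h.1)
        (by
          rintro j m₁ ⟨h₁, h₂, h₃⟩ hj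
          obtain ⟨m₂, t, h, ht, hi₂, hj₂, hF₂, hD₂, hp⟩ := hP i j m₁ h₁ h₂ hj
          exact ⟨m₂, t, h, ht, hj₂, ⟨hF₂, hi₂, fun i' j' h' => hp _ _ (h₃ i' j' h')⟩, hD₂,
            fun j' h' => hp _ _ h'⟩)
        m ⟨hm, hi, fun _ _ h => h⟩
      exact ⟨m', t, h, ht, hi', hF', hD', fun i' h' j' => hp _ _ (h' j')⟩)
    m hm
  exact ⟨m', t, h, ht, hF', hD'⟩

/-- Commands that transform a family of relations: the parallel update of a relation, composition,
and `n`-fold iteration. -/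
inductive Cmd
  | upd (a : ℕ) (φ : Fml)
  | seq (c d : Cmd)
  | iter (c : Cmd)

/-- The memory holds the size, the distinguished vertex and the relations except `1`. -/
structure Holds₁ {n : ℕ} (v₀ : Fin n) (S : Rels n) (m : Memory) : Prop where
  size : m.reg 0 = n
  vertex : m.reg 1 = v₀
  arr : ∀ a ≠ 1, ∀ i j : Fin n, m.arr a i j ≠ 0 ↔ S a i j

/-- The counters below `k` agree. -/
def SameCounters (k : ℕ) (m m' : Memory) : Prop := ∀ i < k, m'.reg (2 * i + 2) = m.reg (2 * i + 2)

theorem Memory.setArr_arr (m : Memory) (a i j v b k l : ℕ) :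
    (m.setArr a i j v).arr b k l = if b = a ∧ k = i ∧ l = j then v else m.arr b k l := rfl

theorem Holds₁.setReg {n : ℕ} {v₀ : Fin n} {S : Rels n} {m : Memory} (h : Holds₁ v₀ S m) {x : ℕ}
    (hx : 2 ≤ x) (v : ℕ) : Holds₁ v₀ S (m.setReg x v) where
  size := by rw [Memory.setReg_reg, if_neg (by omega), h.size]
  vertex := by rw [Memory.setReg_reg, if_neg (by omega), h.vertex]
  arr := h.arr

namespace Cmd

/-- The values of the variables in the formula of an update: the variable `0` is the distinguished
vertex, and `1` and `2` are the arguments of the relation. -/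
def env {n : ℕ} (v₀ x y : Fin n) : ℕ → Fin n :=
  Function.update (Function.update (fun _ => v₀) 1 x) 2 y

/-- The effect of a command. -/
def run {n : ℕ} (v₀ : Fin n) : Cmd → Rels n → Rels n
  | upd a φ, S => Function.update S a fun x y => φ.Holds S 3 (env v₀ x y)
  | seq c d, S => d.run v₀ (c.run v₀ S)
  | iter c, S => (c.run v₀)^[n] S

/-- The relation `1` does not occur, the formulas contain no undeclared variables, and the nesting
depth of the iterations is at most `3 - k`. -/
def Scoped : Cmd → ℕ → Bool
  | upd a φ, k => k ≤ 3 && a != 1 && φ.Scoped 3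
  | seq c d, k => c.Scoped k && d.Scoped k
  | iter c, k => c.Scoped (k + 1)

/-- The program for a command; the counters of the iterations start with the counter `k`. -/
def code : Cmd → ℕ → Program
  | upd a φ, _ => .seq
      (forLoop 3 (forLoop 5 (.seq (φ.code 3) (.store 1 (.reg 3) (.reg 5) (.reg 8)))))
      (forLoop 3 (forLoop 5 (.store a (.reg 3) (.reg 5) (.arr 1 (.reg 3) (.reg 5)))))
  | seq c d, k => .seq (c.code k) (d.code k)
  | iter c, k => forLoop (2 * k + 2) (c.code (k + 1))

/-- A bound for the running time of `Cmd.code`. -/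
noncomputable def time : Cmd → Polynomial ℕ
  | upd _ φ => (((φ.time + 4 + 8) * Polynomial.X + 6) + 8) * Polynomial.X + 6 +
      ((((6 + 8) * Polynomial.X + 6) + 8) * Polynomial.X + 6)
  | seq c d => c.time + d.time
  | iter c => (c.time + 8) * Polynomial.X + 6

/-- The formula may mention `a` itself, so the new relation is first built in the scratch array `1`
and copied afterwards. The variables `0, 1, 2` occupy registers `1, 3, 5` and `φ.code 3` answers in
register `8`; the counters in registers `2, 4, 6` are never touched. -/
theorem exec_upd {n : ℕ} (v₀ : Fin n) (S : Rels n) (a : ℕ) (φ : Fml) (m : Memory) (k : ℕ)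
    (ha : a ≠ 1) (hs : φ.Scoped 3) (hm : Holds₁ v₀ S m) :
    ∃ m' t, Exec ((upd a φ).code k) m m' t ∧ t ≤ (upd a φ).time.eval n ∧ SameCounters 3 m m' ∧
      Holds₁ v₀ ((upd a φ).run v₀ S) m' := by
  obtain ⟨m₁, t₁, hx₁, ht₁, ⟨hF₁, hg₁⟩, hD₁⟩ := exec_forLoop_forLoop_all (n := n) (r := 3) (r' := 5)
    (P := .seq (φ.code 3) (.store 1 (.reg 3) (.reg 5) (.reg 8))) (T := φ.time.eval n + 4)
    (by omega) (by omega) (by omega)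
    (fun m' => Holds₁ v₀ S m' ∧ SameCounters 3 m m')
    (fun i j m' => m'.arr 1 i j ≠ 0 ↔ φ.Holds S 3 (env v₀ i j))
    (by
      rintro m' x v hx ⟨h, h'⟩
      refine ⟨h.setReg (by omega) v, fun y hy => ?_⟩
      rw [Memory.setReg_reg, if_neg (by omega), h' y hy])
    (fun i j m' x v h => h)
    (fun m' h => h.1.size)
    (by
      rintro i j m' ⟨h, h'⟩ hi hj
      obtain ⟨m'', t, he, ht, hag, hr⟩ := φ.exec_code S 3 (env v₀ i j) m' hs
        ⟨h.size, by
          intro x hx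
          interval_cases x
          · exact h.vertex
          · exact hi
          · exact hj, h.arr⟩
      have h3 : m''.reg 3 = i := (hag.2 3 (by omega)).trans hi
      have h5 : m''.reg 5 = j := (hag.2 5 (by omega)).trans hj
      refine ⟨_, _, Exec.seq he (Exec.store _ _ _ _ _), ?_, h3, h5, ⟨⟨?_, ?_, ?_⟩, ?_⟩, ?_, ?_⟩
      · simp only [Expr.cost]; omega
      · exact (hag.2 0 (by omega)).trans h.size
      · exact (hag.2 1 (by omega)).trans h.vertex
      · intro b hb i' j'
        rw [Memory.setArr_arr, if_neg (by tauto), hag.1]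
        exact h.arr b hb i' j'
      · intro x hx
        exact (hag.2 _ (by omega)).trans (h' x hx)
      · rw [Memory.setArr_arr, if_pos ⟨rfl, h3.symm, h5.symm⟩]
        exact hr
      · intro i' j' hD
        rw [Memory.setArr_arr]
        simp only [Expr.eval, h3, h5]
        split_ifs with hc
        · rw [Fin.ext hc.2.1, Fin.ext hc.2.2]; exact hr
        · rw [hag.1]; exact hD)
    m ⟨hm, fun _ _ => rfl⟩
  obtain ⟨m₂, t₂, hx₂, ht₂, ⟨h0, h1, hg₂, ha₁, hb₂⟩, hD₂⟩ := exec_forLoop_forLoop_all (n := n)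
    (r := 3) (r' := 5) (P := .store a (.reg 3) (.reg 5) (.arr 1 (.reg 3) (.reg 5))) (T := 6)
    (by omega) (by omega) (by omega)
    (fun m' => m'.reg 0 = n ∧ m'.reg 1 = v₀ ∧ SameCounters 3 m m' ∧ m'.arr 1 = m₁.arr 1 ∧
      ∀ b ≠ 1, b ≠ a → m'.arr b = m₁.arr b)
    (fun i j m' => m'.arr a i j = m₁.arr 1 i j)
    (by
      rintro m' x v hx ⟨h, h', h'', h₃⟩
      refine ⟨?_, ?_, fun y hy => ?_, h₃⟩
      · rw [Memory.setReg_reg, if_neg (by omega), h]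
      · rw [Memory.setReg_reg, if_neg (by omega), h']
      · rw [Memory.setReg_reg, if_neg (by omega), h'' y hy])
    (fun i j m' x v h => h)
    (fun m' h => h.1)
    (by
      rintro i j m' ⟨h, h', h'', h₁, h₂⟩ hi hj
      refine ⟨_, _, Exec.store _ _ _ _ _, by simp [Expr.cost], hi, hj,
        ⟨h, h', h'', ?_, ?_⟩, ?_, ?_⟩
      · funext x y
        rw [Memory.setArr_arr, if_neg (by tauto), h₁]
      · intro b hb hba
        funext x y
        rw [Memory.setArr_arr, if_neg (by tauto), h₂ b hb hba]
      · rw [Memory.setArr_arr, if_pos ⟨rfl, hi.symm, hj.symm⟩]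
        simp only [Expr.eval, hi, hj, h₁]
      · intro i' j' hD
        rw [Memory.setArr_arr]
        simp only [Expr.eval, hi, hj]
        split_ifs with hc
        · rw [h₁, hc.2.1, hc.2.2]
        · exact hD)
    m₁ ⟨hF₁.size, hF₁.vertex, hg₁, rfl, fun _ _ _ => rfl⟩
  refine ⟨m₂, _, Exec.seq hx₁ hx₂, ?_, hg₂, h0, h1, fun b hb i j => ?_⟩
  · simp only [time, Polynomial.eval_add, Polynomial.eval_mul, Polynomial.eval_X,
        Polynomial.eval_ofNat]
    omega
  · by_cases hba : b = a
    · subst hba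
      rw [hD₂, hD₁, run, Function.update_self]
    · rw [hb₂ b hb hba, run, Function.update_of_ne hba]
      exact hF₁.arr b hb i j

theorem exec_code {n : ℕ} (v₀ : Fin n) (c : Cmd) (S : Rels n) (k : ℕ) (m : Memory)
    (hs : c.Scoped k) (hm : Holds₁ v₀ S m) :
    ∃ m' t, Exec (c.code k) m m' t ∧ t ≤ c.time.eval n ∧ SameCounters k m m' ∧
      Holds₁ v₀ (c.run v₀ S) m' := by
  induction c generalizing S k m with
  | upd a φ =>
    simp only [Scoped, Bool.and_eq_true, decide_eq_true_eq, bne_iff_ne] at hs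
    obtain ⟨m', t, h, ht, hc, hm'⟩ := exec_upd v₀ S a φ m k hs.1.2 hs.2 hm
    exact ⟨m', t, h, ht, fun i hi => hc i (by omega), hm'⟩
  | seq c d ihc ihd =>
    simp only [Scoped, Bool.and_eq_true] at hs
    obtain ⟨m₁, t₁, h₁, ht₁, hc₁, hm₁⟩ := ihc S k m hs.1 hm
    obtain ⟨m₂, t₂, h₂, ht₂, hc₂, hm₂⟩ := ihd _ k m₁ hs.2 hm₁
    refine ⟨m₂, _, Exec.seq h₁ h₂, ?_, fun i hi => (hc₂ i hi).trans (hc₁ i hi), hm₂⟩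
    simp only [time, Polynomial.eval_add]; omega
  | iter c ih =>
    obtain ⟨m', t, h, ht, -, hm', hc⟩ := exec_forLoop (n := n) (r := 2 * k + 2)
      (P := c.code (k + 1)) (T := c.time.eval n) (by omega)
      (fun i m' => Holds₁ v₀ ((c.run v₀)^[i] S) m' ∧ SameCounters k m m')
      (by
        rintro i hi m₁ ⟨h₁, h₂⟩ h0 hk
        obtain ⟨m₂, t, h, ht, hc, hm₂⟩ := ih _ (k + 1) m₁ hs h₁
        refine ⟨m₂, t, h, ht, hm₂.size, (hc k (by omega)).trans hk, ?_, fun x hx => ?_⟩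
        · rw [Function.iterate_succ_apply']
          exact hm₂.setReg (by omega) _
        · rw [Memory.setReg_reg, if_neg (by omega), hc x (by omega), h₂ x hx])
      m hm.size ⟨hm.setReg (by omega) _, fun x hx => by
        rw [Memory.setReg_reg, if_neg (by omega)]⟩
    refine ⟨m', t, h, ?_, hc, hm'⟩
    simpa [time] using ht

end Cmd

/-- The family of relations that an input graph defines. -/
def inputRels {n : ℕ} (G : SimpleGraph (Fin n)) : Rels n := fun a x y => a = 0 ∧ G.Adj x y

theorem holds₁_inputMemory {n : ℕ} (G : SimpleGraph (Fin n)) (v₀ : Fin n) :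
    Holds₁ v₀ (inputRels G) (inputMemory G v₀) where
  size := rfl
  vertex := rfl
  arr a _ i j := by
    have : (∃ u v : Fin n, (u : ℕ) = i ∧ (v : ℕ) = j ∧ G.Adj u v) ↔ G.Adj i j :=
      ⟨fun ⟨u, v, hu, hv, h⟩ => Fin.ext hu ▸ Fin.ext hv ▸ h, fun h => ⟨i, j, rfl, rfl, h⟩⟩
    rw [inputRels, ← this]
    simp only [inputMemory]
    split_ifs with h
    · exact iff_of_true one_ne_zero h
    · exact iff_of_false (not_not.2 rfl) h

/-- Write a coloring to the array `1`: the unary relations `a` and `b` (evaluated on the diagonal)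
are the sets of the blue and the green vertices. The register `0` receives `0` if the relation `f`
holds for the distinguished vertex, and `1` otherwise. -/
def emit (a b f : ℕ) : Program :=
  .seq (forLoop 3 (.store 1 (.reg 3) (.const 0)
    (.add (.lt (.const 0) (.arr a (.reg 3) (.reg 3)))
      (.add (.lt (.const 0) (.arr b (.reg 3) (.reg 3)))
        (.lt (.const 0) (.arr b (.reg 3) (.reg 3)))))))
    (.assign 0 (.eq (.arr f (.reg 1) (.reg 1)) (.const 0)))

open Classical in
theorem exec_emit {n : ℕ} {v₀ : Fin n} {S : Rels n} {m : Memory} {a b f : ℕ} (ha : a ≠ 1)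
    (hb : b ≠ 1) (hf : f ≠ 1) (hm : Holds₁ v₀ S m) :
    ∃ m' t, Exec (emit a b f) m m' t ∧ t ≤ 28 * n + 12 ∧
      m'.reg 0 = (if S f v₀ v₀ then 0 else 1) ∧
      ∀ v : Fin n, m'.arr 1 v 0 = (if S a v v then 1 else 0) + 2 * if S b v v then 1 else 0 := by
  -- One store costs 20. The test for `b` is added twice because the code of green is 2.
  obtain ⟨m', t, h, ht, hF, hD, -⟩ := exec_forLoop_all (n := n) (r := 3) (T := 20)
    (P := .store 1 (.reg 3) (.const 0)
      (.add (.lt (.const 0) (.arr a (.reg 3) (.reg 3)))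
        (.add (.lt (.const 0) (.arr b (.reg 3) (.reg 3)))
          (.lt (.const 0) (.arr b (.reg 3) (.reg 3)))))) (by omega)
    (Holds₁ v₀ S)
    (fun v m => m.arr 1 v 0 = (if S a v v then 1 else 0) + 2 * if S b v v then 1 else 0)
    (fun m v h => h.setReg (by omega) v) (fun _ _ _ h => h) (fun m h => h.size)
    (by
      intro i m hm hi
      have key : ∀ c ≠ 1, (Expr.lt (.const 0) (.arr c (.reg 3) (.reg 3))).eval m =
          if S c i i then 1 else 0 := by
        intro c hc
        simp only [Expr.eval, hi, Nat.pos_iff_ne_zero, hm.arr c hc i i]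
      refine ⟨_, _, Exec.store _ _ _ _ _, by simp [Expr.cost], hi, ⟨hm.size, hm.vertex, ?_⟩, ?_, ?_⟩
      · intro c hc x y
        rw [Memory.setArr_arr, if_neg (by tauto)]
        exact hm.arr c hc x y
      · rw [Memory.setArr_arr, if_pos ⟨rfl, hi.symm, rfl⟩]
        rw [Expr.eval, Expr.eval, key a ha, key b hb]
        omega
      · intro j hj
        rw [Memory.setArr_arr]
        by_cases hc : (j : ℕ) = m.reg 3
        · have : j = i := Fin.ext (hc.trans hi)
          rw [if_pos ⟨rfl, hc, rfl⟩, this, Expr.eval, Expr.eval, key a ha, key b hb]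
          omega
        · rw [if_neg fun h => hc h.2.1]
          exact hj)
    m hm
  refine ⟨_, _, Exec.seq h (Exec.assign _ _ _), ?_, ?_, fun v => hD v⟩
  · simp only [Expr.cost]; omega
  · simp only [Memory.setReg_reg, if_true, Expr.eval, hF.vertex]
    have := hF.arr f hf v₀ v₀
    by_cases hS : S f v₀ v₀ <;> simp_all

open Classical in
/-- Every scoped command has a polynomial-time program that writes out three of the relations that
it computes. -/
theorem exists_program (c : Cmd) (hc : c.Scoped 0) {a b f : ℕ} (ha : a ≠ 1) (hb : b ≠ 1)
    (hf : f ≠ 1) :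
    ∃ (P : Program) (p : Polynomial ℕ), ∀ (n : ℕ) (G : SimpleGraph (Fin n)) (v₀ : Fin n),
      ∃ m t, Exec P (inputMemory G v₀) m t ∧ t ≤ p.eval n ∧
        m.reg 0 = (if c.run v₀ (inputRels G) f v₀ v₀ then 0 else 1) ∧
        ∀ v : Fin n, m.arr 1 v 0 = (if c.run v₀ (inputRels G) a v v then 1 else 0) +
          2 * if c.run v₀ (inputRels G) b v v then 1 else 0 := by
  refine ⟨.seq (c.code 0) (emit a b f), c.time + (28 * Polynomial.X + 12), fun n G v₀ => ?_⟩
  obtain ⟨m₁, t₁, h₁, ht₁, -, hm₁⟩ := c.exec_code v₀ _ 0 _ hc (holds₁_inputMemory G v₀)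
  obtain ⟨m₂, t₂, h₂, ht₂, hf, hv⟩ := exec_emit ha hb hf hm₁
  refine ⟨m₂, _, Exec.seq h₁ h₂, ?_, hf, hv⟩
  simp only [Polynomial.eval_add, Polynomial.eval_mul, Polynomial.eval_X, Polynomial.eval_ofNat]
  omega

end Compiler

/-! ### Reductions as vertex maps, and the invariant they preserve -/

section Invariants

variable {V : Type*}

theorem redirect_self (u v : V) : redirect u v u = v := if_pos rfl

theorem redirect_of_ne {u v x : V} (h : x ≠ u) : redirect u v x = x := if_neg h

/-- The image of a state under a map of the vertices. -/
def State.mapBy (s : State V) (f : V → V) : State V where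
  verts := f '' s.verts
  graph := s.graph.map f
  root := f s.root
  rep := f ∘ s.rep

/-- The input graph as a state. -/
def initialState (G : SimpleGraph V) (v₀ : V) : State V := ⟨Set.univ, G, v₀, id⟩

theorem mergedState_eq {G : SimpleGraph V} {v₀ : V} {m : V → V} (h : m v₀ = v₀) :
    mergedState G v₀ m = (initialState G v₀).mapBy m := by
  simp [mergedState, State.mapBy, initialState, h]

/-- The adjacent vertices are among the vertices of the state. -/
def State.AdjMem (s : State V) : Prop := ∀ x y, s.graph.Adj x y → x ∈ s.verts

/-- `a` can be merged into `b`, or removed because of `b`. -/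
def State.Candidate (s : State V) (a b : V) : Prop :=
  (∃ c d, IsDiamond s.graph a b c d) ∨ (a ∈ s.verts ∧ b ∈ s.verts ∧ IsSibling s.graph a b)

theorem IsSibling.not_adj {H : SimpleGraph V} {u v : V} (h : IsSibling H u v) : ¬ H.Adj u v :=
  fun h' => H.loopless.irrefl _ (h.2 h')

namespace State

variable {s : State V} {a b : V}

theorem Candidate.ne (h : s.Candidate a b) : a ≠ b := by
  rcases h with ⟨c, d, h⟩ | h
  exacts [h.1, h.2.2.1]

theorem Candidate.not_adj (h : s.Candidate a b) : ¬ s.graph.Adj a b := by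
  rcases h with ⟨c, d, h⟩ | h
  exacts [h.2.1, h.2.2.not_adj]

theorem Candidate.left_mem (h : s.Candidate a b) (hs : s.AdjMem) : a ∈ s.verts := by
  rcases h with ⟨c, d, h⟩ | h
  exacts [hs _ _ h.2.2.1, h.1]

theorem Candidate.right_mem (h : s.Candidate a b) (hs : s.AdjMem) : b ∈ s.verts := by
  rcases h with ⟨c, d, h⟩ | h
  exacts [hs _ _ h.2.2.2.2.1, h.2.1]

theorem image_redirect {A : Set V} (hab : a ≠ b) (hb : b ∈ A) :
    redirect a b '' A = A \ {a} := by
  ext x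
  constructor
  · rintro ⟨y, hy, rfl⟩
    by_cases h : y = a
    · rw [h, redirect_self]; exact ⟨hb, hab.symm⟩
    · rw [redirect_of_ne h]; exact ⟨hy, h⟩
  · rintro ⟨hx, h⟩
    exact ⟨x, hx, redirect_of_ne h⟩

theorem mergeInto_eq (hab : a ≠ b) (hb : b ∈ s.verts) :
    s.mergeInto a b = s.mapBy (redirect a b) := by
  rw [mergeInto, mapBy, image_redirect hab hb]

/-- Since `N(a) ⊆ N(b)`, the edges of `a` land on existing edges of `b`. This makes a removal a
special case of a merging. -/
theorem map_redirect_of_isSibling {H : SimpleGraph V} (h : IsSibling H a b) :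
    H.map (redirect a b) = H.deleteIncidenceSet a := by
  ext x y
  rw [SimpleGraph.map_adj', SimpleGraph.deleteIncidenceSet_adj]
  constructor
  · rintro ⟨-, x', y', hxy, rfl, rfl⟩
    by_cases hx : x' = a
    · subst hx
      have hy : y' ≠ x' := hxy.ne'
      rw [redirect_self, redirect_of_ne hy]
      exact ⟨h.2 hxy, h.1.symm, hy⟩
    · rw [redirect_of_ne hx]
      by_cases hy : y' = a
      · subst hy
        rw [redirect_self]
        exact ⟨(h.2 hxy.symm : H.Adj b x').symm, hx, h.1.symm⟩
      · rw [redirect_of_ne hy]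
        exact ⟨hxy, hx, hy⟩
  · rintro ⟨hxy, hx, hy⟩
    exact ⟨hxy.ne, x, y, hxy, redirect_of_ne hx, redirect_of_ne hy⟩

theorem removeFor_eq (h : IsSibling s.graph a b) (hb : b ∈ s.verts) :
    s.removeFor a b = s.mapBy (redirect a b) := by
  rw [removeFor, mapBy, image_redirect h.1 hb, map_redirect_of_isSibling h]

end State

/-- Puts both rules into one form, so that an invariant has to be checked only for images under
`redirect`. -/
theorem reduce_iff {s s' : State V} (hs : s.AdjMem) :
    Reduce s s' ↔ ∃ a b, s.Candidate a b ∧ s' = s.mapBy (redirect a b) := by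
  constructor
  · rintro (⟨a, b, c, d, h⟩ | ⟨u, v, hu, hv, h⟩)
    · exact ⟨a, b, Or.inl ⟨c, d, h⟩,
        State.mergeInto_eq h.1 (hs _ _ h.2.2.2.2.1)⟩
    · exact ⟨u, v, Or.inr ⟨hu, hv, h⟩, State.removeFor_eq h hv⟩
  · rintro ⟨a, b, ⟨c, d, h⟩ | ⟨ha, hb, h⟩, rfl⟩
    · rw [← State.mergeInto_eq h.1 (hs _ _ h.2.2.2.2.1)]
      exact .diamond s a b c d h
    · rw [← State.removeFor_eq h hb]
      exact .siblings s a b ha hb h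

/-- The map sends adjacent vertices to distinct vertices. -/
def Separates (H : SimpleGraph V) (f : V → V) : Prop := ∀ x y, H.Adj x y → f x ≠ f y

theorem separates_redirect {H : SimpleGraph V} {a b : V} (h : ¬ H.Adj a b) :
    Separates H (redirect a b) := by
  intro x y hxy heq
  by_cases hx : x = a <;> by_cases hy : y = a
  · exact hxy.ne (hx.trans hy.symm)
  · rw [hx, redirect_self, redirect_of_ne hy] at heq
    exact h (hx ▸ heq ▸ hxy)
  · rw [hy, redirect_self, redirect_of_ne hx] at heq
    exact h (hy ▸ heq ▸ hxy.symm)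
  · rw [redirect_of_ne hx, redirect_of_ne hy] at heq
    exact hxy.ne heq

theorem State.Candidate.separates {s : State V} {a b : V} (h : s.Candidate a b) :
    Separates s.graph (redirect a b) :=
  separates_redirect h.not_adj

namespace State

variable {s : State V} {f : V → V}

theorem mapBy_adj (hf : Separates s.graph f) {x y : V} :
    (s.mapBy f).graph.Adj x y ↔ ∃ x' y', s.graph.Adj x' y' ∧ f x' = x ∧ f y' = y := by
  refine (SimpleGraph.map_adj' f s.graph x y).trans ⟨fun h => h.2, fun h => ⟨?_, h⟩⟩
  obtain ⟨x', y', h, rfl, rfl⟩ := h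
  exact hf _ _ h

theorem adj_mapBy (hf : Separates s.graph f) {x y : V} (h : s.graph.Adj x y) :
    (s.mapBy f).graph.Adj (f x) (f y) := (mapBy_adj hf).2 ⟨x, y, h, rfl, rfl⟩

theorem mem_nbhd_mapBy (hf : Separates s.graph f) {x : V} (h : x ∈ s.nbhd) :
    f x ∈ (s.mapBy f).nbhd := adj_mapBy hf h

theorem mem_rest {x : V} : x ∈ s.rest ↔ x ∈ s.verts ∧ x ≠ s.root ∧ x ∉ s.nbhd := by
  simp [rest, closedNbhd, nbhd]

/-- The root and its neighbors stay in the closed neighborhood of the root under a separating map,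
so nothing new can appear outside it. -/
theorem mem_rest_of_mapBy (hf : Separates s.graph f) {x : V} (hx : x ∈ s.verts)
    (h : f x ∈ (s.mapBy f).rest) : x ∈ s.rest := by
  rw [mem_rest] at h ⊢
  exact ⟨hx, fun h' => h.2.1 (congrArg f h'), fun h' => h.2.2 (mem_nbhd_mapBy hf h')⟩

/-- The properties of a state that are inherited by all its images. -/
structure Basic (G : SimpleGraph V) (s : State V) : Prop where
  adjMem : s.AdjMem
  root_mem : s.root ∈ s.verts
  hom : ∀ x y, G.Adj x y → s.graph.Adj (s.rep x) (s.rep y)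
  diam : ∀ x ∈ s.verts, ∀ y ∈ s.verts,
    x = y ∨ s.graph.Adj x y ∨ ∃ z, s.graph.Adj x z ∧ s.graph.Adj z y

theorem Basic.mapBy {G : SimpleGraph V} (h : s.Basic G) (hf : Separates s.graph f) :
    (s.mapBy f).Basic G where
  adjMem x y hxy := by
    obtain ⟨x', y', h', rfl, rfl⟩ := (mapBy_adj hf).1 hxy
    exact ⟨x', h.adjMem _ _ h', rfl⟩
  root_mem := ⟨_, h.root_mem, rfl⟩
  hom x y hxy := adj_mapBy hf (h.hom x y hxy)
  diam := by
    rintro _ ⟨x, hx, rfl⟩ _ ⟨y, hy, rfl⟩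
    rcases h.diam x hx y hy with rfl | h' | ⟨z, h₁, h₂⟩
    · exact Or.inl rfl
    · exact Or.inr (Or.inl (adj_mapBy hf h'))
    · exact Or.inr (Or.inr ⟨f z, adj_mapBy hf h₁, adj_mapBy hf h₂⟩)

/-- `x` has two adjacent neighbors in the neighborhood of the root. -/
def Fan (s : State V) (x : V) : Prop :=
  ∃ c ∈ s.nbhd, ∃ d ∈ s.nbhd, s.graph.Adj c d ∧ s.graph.Adj x c ∧ s.graph.Adj x d

theorem Fan.mapBy (hf : Separates s.graph f) {x : V} (h : s.Fan x) : (s.mapBy f).Fan (f x) := by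
  obtain ⟨c, hc, d, hd, h₁, h₂, h₃⟩ := h
  exact ⟨f c, mem_nbhd_mapBy hf hc, f d, mem_nbhd_mapBy hf hd, adj_mapBy hf h₁, adj_mapBy hf h₂,
    adj_mapBy hf h₃⟩

/-- A vertex outside the closed neighborhood of the root has at most one neighbor there, unless it
will have to be merged with the root. -/
def Thin (s : State V) : Prop :=
  ∀ x ∈ s.rest, ∀ y ∈ s.rest, ∀ z ∈ s.rest, s.graph.Adj x y → s.graph.Adj x z → y ≠ z → s.Fan x

/-- A proper coloring in which the root is red, and the vertices outside its closed neighborhood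
are red and blue. -/
structure IsGood (s : State V) (χ : V → Color) : Prop where
  proper : ∀ x y, s.graph.Adj x y → χ x ≠ χ y
  root : χ s.root = .red
  rest : ∀ x ∈ s.rest, χ x = .red ∨ χ x = .blue

theorem rest_adj_of_mapBy (hs : s.AdjMem) (hf : Separates s.graph f) {x y : V}
    (hx : x ∈ (s.mapBy f).rest) (hy : y ∈ (s.mapBy f).rest) (h : (s.mapBy f).graph.Adj x y) :
    ∃ x' ∈ s.rest, ∃ y' ∈ s.rest, s.graph.Adj x' y' ∧ f x' = x ∧ f y' = y := by
  obtain ⟨x', y', h', rfl, rfl⟩ := (mapBy_adj hf).1 h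
  exact ⟨x', mem_rest_of_mapBy hf (hs _ _ h') hx, y', mem_rest_of_mapBy hf (hs _ _ h'.symm) hy, h',
    rfl, rfl⟩

variable {a b : V}

theorem redirect_eq {x y : V} (h : redirect a b x = y) : x = y ∨ x = a ∧ y = b := by
  by_cases hx : x = a
  · rw [hx, redirect_self] at h
    exact Or.inr ⟨hx, h.symm⟩
  · rw [redirect_of_ne hx] at h
    exact Or.inl h

/-- The only danger is that `x` arises from two vertices `x₁`, `x₂` that contribute one neighbor
each. For siblings, the larger neighborhood already contains both neighbors. For a diamond, the two
central vertices lie in the neighborhood of the root, and then `x₁` is already a fan. -/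
theorem Thin.redirect (ht : s.Thin) (hs : s.AdjMem) (h : s.Candidate a b) :
    (s.mapBy (redirect a b)).Thin := by
  have hf := h.separates
  intro x hx y hy z hz hxy hxz hyz
  obtain ⟨x₁, hx₁, y', hy', h₁, e₁, rfl⟩ := rest_adj_of_mapBy hs hf hx hy hxy
  obtain ⟨x₂, hx₂, z', hz', h₂, e₂, rfl⟩ := rest_adj_of_mapBy hs hf hx hz hxz
  have hyz' : y' ≠ z' := fun e => hyz (e ▸ rfl)
  by_contra hF
  have hF₁ : ¬ s.Fan x₁ := fun h' => hF (e₁ ▸ h'.mapBy hf)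
  have hF₂ : ¬ s.Fan x₂ := fun h' => hF (e₂ ▸ h'.mapBy hf)
  by_cases hx₁₂ : x₁ = x₂
  · subst hx₁₂
    exact hF₁ (ht _ hx₁ _ hy' _ hz' h₁ h₂ hyz')
  -- If `c` were in `rest`, thinness would make it the only neighbor in `rest` of both `x₁` and
  -- `x₂`, so that `y' = c = z'`.
  have key : ∀ c d, IsDiamond s.graph x₁ x₂ c d → c ∈ s.rest → False := by
    rintro c d ⟨-, -, h₁c, -, h₂c, -, -⟩ hc
    have ey : y' = c := by
      by_contra hne
      exact hF₁ (ht _ hx₁ _ hy' _ hc h₁ h₁c hne)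
    have ez : z' = c := by
      by_contra hne
      exact hF₂ (ht _ hx₂ _ hz' _ hc h₂ h₂c hne)
    exact hyz' (ey.trans ez.symm)
  have dia : ∀ c d, IsDiamond s.graph x₁ x₂ c d → False := by
    intro c d hD
    have hc := key c d hD
    have hd := key d c ⟨hD.1, hD.2.1, hD.2.2.2.1, hD.2.2.1, hD.2.2.2.2.2.1, hD.2.2.2.2.1,
      hD.2.2.2.2.2.2.symm⟩
    have hN : ∀ e, s.graph.Adj x₁ e → (e ∈ s.rest → False) → e ∈ s.nbhd := by
      intro e he h'
      by_contra hne
      refine h' (mem_rest.2 ⟨hs _ _ he.symm, ?_, hne⟩)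
      rintro rfl
      exact (mem_rest.1 hx₁).2.2 he.symm
    exact hF₁ ⟨c, hN c hD.2.2.1 hc, d, hN d hD.2.2.2.1 hd, hD.2.2.2.2.2.2, hD.2.2.1, hD.2.2.2.1⟩
  rcases redirect_eq e₁ with rfl | ⟨rfl, rfl⟩
  · rcases redirect_eq e₂ with rfl | ⟨rfl, rfl⟩
    · exact hx₁₂ rfl
    · rcases h with ⟨c, d, hD⟩ | ⟨-, -, hS⟩
      · exact dia c d ⟨hD.1.symm, fun h => hD.2.1 h.symm, hD.2.2.2.2.1, hD.2.2.2.2.2.1, hD.2.2.1,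
          hD.2.2.2.1, hD.2.2.2.2.2.2⟩
      · exact hF₁ (ht _ hx₁ _ hy' _ hz' h₁ (hS.2 h₂) hyz')
  · rcases redirect_eq e₂ with rfl | ⟨rfl, -⟩
    · rcases h with ⟨c, d, hD⟩ | ⟨-, -, hS⟩
      · exact dia c d hD
      · exact hF₂ (ht _ hx₂ _ hy' _ hz' (hS.2 h₁) h₂ hyz')
    · exact hx₁₂ rfl

theorem Color.eq_of_ne {p q r t : Color} (h : p ≠ q) (h₁ : r ≠ p) (h₂ : r ≠ q) (h₃ : t ≠ p)
    (h₄ : t ≠ q) : r = t := by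
  cases p <;> cases q <;> cases r <;> cases t <;> simp_all

theorem rest_redirect_subset (hs : s.AdjMem) (h : s.Candidate a b) :
    (s.mapBy (redirect a b)).rest ⊆ s.rest := by
  intro x hx
  have hx' := (mem_rest.1 hx).1
  rw [mapBy, image_redirect h.ne (h.right_mem hs)] at hx'
  refine mem_rest_of_mapBy h.separates hx'.1 ?_
  rwa [redirect_of_ne hx'.2]

/-- The non-adjacent vertices of a diamond get the same color in every 3-coloring, so the coloring
descends; for siblings the new graph is a subgraph. -/
theorem IsGood.redirect {χ : V → Color} (hχ : s.IsGood χ) (hs : s.AdjMem) (h : s.Candidate a b) :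
    ∃ χ', (s.mapBy (redirect a b)).IsGood χ' := by
  have hsub := rest_redirect_subset hs h
  have h' := h
  rcases h with ⟨c, d, hD⟩ | ⟨ha, hb, hS⟩
  · have hab : χ a = χ b := Color.eq_of_ne (hχ.proper _ _ hD.2.2.2.2.2.2) (hχ.proper _ _ hD.2.2.1)
      (hχ.proper _ _ hD.2.2.2.1) (hχ.proper _ _ hD.2.2.2.2.1) (hχ.proper _ _ hD.2.2.2.2.2.1)
    have hr : ∀ x, χ (ThreeCol.redirect a b x) = χ x := by
      intro x
      by_cases hx : x = a
      · rw [hx, redirect_self, hab]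
      · rw [redirect_of_ne hx]
    refine ⟨χ, ?_, (hr _).trans hχ.root, fun x hx => hχ.rest x (hsub hx)⟩
    intro x y hxy
    obtain ⟨x', y', hxy', rfl, rfl⟩ := (mapBy_adj h'.separates).1 hxy
    rw [hr, hr]
    exact hχ.proper _ _ hxy'
  · have hadj : ∀ x y, (s.mapBy (ThreeCol.redirect a b)).graph.Adj x y → s.graph.Adj x y := by
      intro x y hxy
      rw [mapBy, map_redirect_of_isSibling hS, SimpleGraph.deleteIncidenceSet_adj] at hxy
      exact hxy.1
    -- If the root is removed, its successor `b` comes from `rest` and may be blue. Swapping red and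
    -- blue repairs this, because the new `rest` is part of the old one and so shows no green.
    by_cases hr : s.root = a
    · have hroot : (s.mapBy (ThreeCol.redirect a b)).root = b := by
        rw [mapBy, hr, redirect_self]
      have hbr : b ∈ s.rest := mem_rest.2 ⟨hb, fun e => hS.1 (hr.symm.trans e.symm),
        fun e => hS.not_adj (hr ▸ e)⟩
      rcases hχ.rest b hbr with hb | hb
      · exact ⟨χ, fun x y h => hχ.proper _ _ (hadj _ _ h), by rw [hroot, hb],
          fun x hx => hχ.rest x (hsub hx)⟩
      · refine ⟨fun x => Equiv.swap .red .blue (χ x),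
          fun x y h => (Equiv.swap _ _).injective.ne (hχ.proper _ _ (hadj _ _ h)), ?_, ?_⟩
        · rw [hroot, hb, Equiv.swap_apply_right]
        · intro x hx
          rcases hχ.rest x (hsub hx) with h | h <;> simp [h]
    · exact ⟨χ, fun x y h => hχ.proper _ _ (hadj _ _ h),
        by rw [mapBy, redirect_of_ne hr]; exact hχ.root, fun x hx => hχ.rest x (hsub hx)⟩

/-- The invariant of the reduction loop. -/
structure Invariant (G : SimpleGraph V) (s : State V) : Prop extends s.Basic G where
  thin : s.Thin
  good : G.Colorable 3 → ∃ χ, s.IsGood χ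

theorem Invariant.redirect {G : SimpleGraph V} (h : s.Invariant G) (hab : s.Candidate a b) :
    (s.mapBy (redirect a b)).Invariant G where
  toBasic := h.toBasic.mapBy hab.separates
  thin := h.thin.redirect h.adjMem hab
  good hG := by
    obtain ⟨χ, hχ⟩ := h.good hG
    exact hχ.redirect h.adjMem hab

theorem Invariant.reduce {G : SimpleGraph V} {s' : State V} (h : s.Invariant G) (hr : Reduce s s') :
    s'.Invariant G := by
  obtain ⟨a, b, hab, rfl⟩ := (reduce_iff h.adjMem).1 hr
  exact h.redirect hab

end State

end Invariants

/-! ### Diameter 2, the articulation neighborhood, and the first merging -/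

section Merging

variable {V : Type*} {G : SimpleGraph V} {v₀ : V}

/-- Any two vertices are equal, adjacent, or have a common neighbor. -/
def TwoConnecting (G : SimpleGraph V) : Prop :=
  ∀ x y, x = y ∨ G.Adj x y ∨ ∃ z, G.Adj x z ∧ G.Adj z y

theorem twoConnecting_of_diam_eq_two (h : G.diam = 2) : TwoConnecting G := by
  -- An infinite diameter would be recorded as `diam = 0`, so the value 2 also gives connectedness.
  have hne : G.ediam ≠ ⊤ := SimpleGraph.ediam_ne_top_of_diam_ne_zero (by omega)
  intro x y
  obtain ⟨p, hp⟩ :=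
    (SimpleGraph.preconnected_of_ediam_ne_top hne x y).exists_walk_length_eq_dist
  have hle := SimpleGraph.dist_le_diam hne (u := x) (v := y)
  match p, hp with
  | .nil, _ => exact Or.inl rfl
  | .cons h₁ .nil, _ => exact Or.inr (Or.inl h₁)
  | .cons h₁ (.cons h₂ .nil), _ => exact Or.inr (Or.inr ⟨_, h₁, h₂⟩)
  | .cons h₁ (.cons h₂ (.cons h₃ p)), hp =>
    simp only [SimpleGraph.Walk.length_cons] at hp
    omega

theorem notMem_closedNbhd {x : V} : x ∉ closedNbhd G v₀ ↔ x ≠ v₀ ∧ ¬ G.Adj v₀ x := by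
  simp [closedNbhd]

theorem colorable_three_iff : G.Colorable 3 ↔ ∃ χ : V → Color, ∀ x y, G.Adj x y → χ x ≠ χ y := by
  constructor
  · rintro ⟨c⟩
    have hinj : Function.Injective ![Color.red, .blue, .green] := by decide
    exact ⟨fun x => ![Color.red, .blue, .green] (c x), fun x y h => hinj.ne (c.valid h)⟩
  · rintro ⟨χ, h⟩
    let f : Color → Fin 3 := fun c => match c with | .red => 0 | .blue => 1 | .green => 2
    have hf : Function.Injective f := by
      intro a b hab
      cases a <;> cases b <;> first | rfl | exact absurd hab (by decide)
    exact ⟨SimpleGraph.Coloring.mk (fun x => f (χ x)) fun {x y} hxy => hf.ne (h x y hxy)⟩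

/-- The common neighbor is not `v₀`, and outside `N[v₀]` it would connect the two components. -/
theorem exists_common_of_not_reachable (hG : TwoConnecting G) {x y : ↥(closedNbhd G v₀)ᶜ}
    (h : ¬ (outside G v₀).Reachable x y) : ∃ z, G.Adj v₀ z ∧ G.Adj x z ∧ G.Adj z y := by
  rcases hG x y with h' | h' | ⟨z, h₁, h₂⟩
  · exact absurd (Subtype.ext h' ▸ SimpleGraph.Reachable.refl x) h
  · exact absurd (SimpleGraph.Adj.reachable (G := outside G v₀) h') h
  · refine ⟨z, ?_, h₁, h₂⟩
    by_contra hz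
    by_cases hzv : z = v₀
    · exact (notMem_closedNbhd.1 x.2).2 (hzv ▸ h₁.symm)
    · let z' : ↥(closedNbhd G v₀)ᶜ := ⟨z, notMem_closedNbhd.2 ⟨hzv, hz⟩⟩
      have e₁ : (outside G v₀).Adj x z' := h₁
      have e₂ : (outside G v₀).Adj z' y := h₂
      exact h (e₁.reachable.trans e₂.reachable)

/-- A blue and a green vertex in different components would force their common neighbor in `N(v₀)`
to be red. So `b` and `g` share a component, and any other component can contain neither blue nor
green. -/
theorem not_blue_and_green (hi : IsIrreducible G) (hG : TwoConnecting G)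
    (ha : IsArticulationNbhd G v₀) {χ : V → Color} (hχ : ∀ x y, G.Adj x y → χ x ≠ χ y)
    (hr : χ v₀ = .red) {b g : ↥(closedNbhd G v₀)ᶜ} (hb : χ b = .blue) (hg : χ g = .green) :
    False := by
  have cross : ∀ x y : ↥(closedNbhd G v₀)ᶜ, ¬ (outside G v₀).Reachable x y →
      χ x = .blue → χ y = .green → False := by
    intro x y hxy hx hy
    obtain ⟨z, h₀, h₁, h₂⟩ := exists_common_of_not_reachable hG hxy
    have e₀ := hχ _ _ h₀
    have e₁ := hχ _ _ h₁
    have e₂ := hχ _ _ h₂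
    rw [hr] at e₀
    rw [hx] at e₁
    rw [hy] at e₂
    cases h : χ z <;> simp_all
  have hbg : (outside G v₀).Reachable b g := by
    by_contra h
    exact cross b g h hb hg
  obtain ⟨y, hy⟩ : ∃ y, ¬ (outside G v₀).Reachable b y := by
    by_contra! h
    exact ha fun x y => (h x).symm.trans (h y)
  have hred : ∀ z, (outside G v₀).Reachable y z → χ z = .red := by
    intro z hz
    have h₁ : ¬ (outside G v₀).Reachable b z := fun h => hy (h.trans hz.symm)
    cases h : χ z
    · rfl
    · exact (cross z g (fun h' => h₁ (hbg.trans h'.symm)) h hg).elim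
    · exact (cross b z h₁ hb h).elim
  -- An entirely red component has no edge, so all neighbors of `y` lie in `N(v₀)` and R2 would
  -- apply to `y` and `v₀`.
  refine hi.2.2 ⟨y, v₀, (notMem_closedNbhd.1 y.2).1, fun z hz => ?_⟩
  by_contra hzv
  have hz' : G.Adj y z := hz
  have hzv₀ : z ≠ v₀ := by
    rintro rfl
    exact (notMem_closedNbhd.1 y.2).2 hz'.symm
  let z' : ↥(closedNbhd G v₀)ᶜ := ⟨z, notMem_closedNbhd.2 ⟨hzv₀, hzv⟩⟩
  have e : (outside G v₀).Adj y z' := hz'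
  exact hχ _ _ hz' ((hred y (SimpleGraph.Reachable.refl y)).trans (hred z' e.reachable).symm)

theorem exists_red_blue_coloring (hi : IsIrreducible G) (hG : TwoConnecting G)
    (ha : IsArticulationNbhd G v₀) (h : G.Colorable 3) :
    ∃ χ : V → Color, (∀ x y, G.Adj x y → χ x ≠ χ y) ∧ χ v₀ = .red ∧
      ∀ x ∉ closedNbhd G v₀, χ x = .red ∨ χ x = .blue := by
  obtain ⟨χ, hχ, hr⟩ : ∃ χ : V → Color, (∀ x y, G.Adj x y → χ x ≠ χ y) ∧ χ v₀ = .red := by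
    obtain ⟨χ, hχ⟩ := colorable_three_iff.1 h
    exact ⟨fun x => Equiv.swap (χ v₀) .red (χ x),
      fun x y h => (Equiv.swap _ _).injective.ne (hχ x y h), Equiv.swap_apply_left _ _⟩
  by_cases hb : ∃ b : ↥(closedNbhd G v₀)ᶜ, χ b = .blue
  · obtain ⟨b, hb⟩ := hb
    refine ⟨χ, hχ, hr, fun x hx => ?_⟩
    cases hx' : χ x
    · exact Or.inl rfl
    · exact Or.inr rfl
    · exact (not_blue_and_green hi hG ha hχ hr hb (g := ⟨x, hx⟩) hx').elim
  · refine ⟨fun x => Equiv.swap .blue .green (χ x),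
      fun x y h => (Equiv.swap _ _).injective.ne (hχ x y h), ?_, fun x hx => ?_⟩
    · simp only [hr]; rfl
    · have : χ x ≠ .blue := fun h => hb ⟨⟨x, hx⟩, h⟩
      cases hx' : χ x
      · left; simp only [hx']; rfl
      · exact absurd hx' this
      · right; simp only [hx']; rfl

theorem not_colorable_of_not_colorable_outside (hi : IsIrreducible G) (hG : TwoConnecting G)
    (ha : IsArticulationNbhd G v₀) (h : ¬ (outside G v₀).Colorable 2) : ¬ G.Colorable 3 := by
  intro h3
  obtain ⟨χ, hχ, -, hrb⟩ := exists_red_blue_coloring hi hG ha h3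
  refine h ⟨SimpleGraph.Coloring.mk
    (fun x : ↥(closedNbhd G v₀)ᶜ => if χ x = .red then (0 : Fin 2) else 1) fun {x y} hxy => ?_⟩
  have hne := hχ x y hxy
  rcases hrb x x.2 with hx | hx <;> rcases hrb y y.2 with hy | hy <;> simp_all

section

variable {c : (outside G v₀).Coloring Bool} {m : V → V}

theorem IsMerging.eq_iff (hm : IsMerging G v₀ c m) (x y : ↥(closedNbhd G v₀)ᶜ) :
    m x = m y ↔ (outside G v₀).Reachable x y ∧ c x = c y := by
  refine ⟨fun h => ?_, fun h => hm.2.2 x y h.1 h.2⟩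
  obtain ⟨x', hx, hrx, hcx⟩ := hm.2.1 x
  obtain ⟨y', hy, hry, hcy⟩ := hm.2.1 y
  have : x' = y' := Subtype.ext (hx.symm.trans (h.trans hy))
  subst this
  exact ⟨hrx.trans hry.symm, hcx.trans hcy.symm⟩

theorem IsMerging.root (hm : IsMerging G v₀ c m) : m v₀ = v₀ := hm.1 _ (Set.mem_insert _ _)

theorem IsMerging.mem_iff (hm : IsMerging G v₀ c m) (x : V) :
    m x ∈ closedNbhd G v₀ ↔ x ∈ closedNbhd G v₀ := by
  by_cases hx : x ∈ closedNbhd G v₀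
  · rw [hm.1 x hx]
  · obtain ⟨y, hy, -⟩ := hm.2.1 ⟨x, hx⟩
    simp only at hy
    rw [hy]
    exact iff_of_false y.2 hx

theorem IsMerging.separates (hm : IsMerging G v₀ c m) : Separates G m := by
  intro x y hxy heq
  by_cases hx : x ∈ closedNbhd G v₀
  · have hy : y ∈ closedNbhd G v₀ := by rwa [← hm.mem_iff, ← heq, hm.mem_iff]
    rw [hm.1 x hx, hm.1 y hy] at heq
    exact hxy.ne heq
  · have hy : y ∉ closedNbhd G v₀ := by rwa [← hm.mem_iff, ← heq, hm.mem_iff]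
    have hadj : (outside G v₀).Adj ⟨x, hx⟩ ⟨y, hy⟩ := hxy
    exact c.valid hadj ((hm.eq_iff ⟨x, hx⟩ ⟨y, hy⟩).1 heq).2

theorem initialState_rest : (initialState G v₀).rest = (closedNbhd G v₀)ᶜ := by
  rw [State.rest, initialState, ← Set.compl_eq_univ_sdiff]

/-- Along a walk both 2-colorings alternate, so they induce the same classes on a component. -/
theorem coloring_eq_iff {χ : V → Color} (hχ : ∀ x y, G.Adj x y → χ x ≠ χ y)
    (hrb : ∀ x ∉ closedNbhd G v₀, χ x = .red ∨ χ x = .blue) {x y : ↥(closedNbhd G v₀)ᶜ}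
    (h : (outside G v₀).Reachable x y) : c x = c y ↔ χ x = χ y := by
  rw [SimpleGraph.reachable_iff_reflTransGen] at h
  induction h with
  | refl => simp
  | @tail y z _ hyz ih =>
    have h₁ := c.valid hyz
    have h₂ := hχ y z hyz
    rcases hrb x x.2 with hx | hx <;> rcases hrb y y.2 with hy | hy <;>
      rcases hrb z z.2 with hz | hz <;> cases hcx : c x <;> cases hcy : c y <;>
      cases hcz : c z <;> simp_all

/-- Thinness holds vacuously: all outside neighbors of a merged class lie in the opposite class of
the same component, which has become one vertex. The red-blue coloring is constant on the merged
classes and hence descends. -/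
theorem IsMerging.invariant (hm : IsMerging G v₀ c m) (hi : IsIrreducible G) (hG : TwoConnecting G)
    (ha : IsArticulationNbhd G v₀) : (mergedState G v₀ m).Invariant G := by
  have hadj : (initialState G v₀).AdjMem := fun _ _ _ => Set.mem_univ _
  have hb : (initialState G v₀).Basic G :=
    ⟨hadj, Set.mem_univ _, fun _ _ h => h, fun x _ y _ => hG x y⟩
  have hf : Separates (initialState G v₀).graph m := hm.separates
  rw [mergedState_eq hm.root]
  refine ⟨hb.mapBy hf, ?_, fun h3 => ?_⟩
  · intro x hx y hy z hz hxy hxz hyz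
    obtain ⟨x₁, hx₁, y', hy', h₁, rfl, rfl⟩ := State.rest_adj_of_mapBy hadj hf hx hy hxy
    obtain ⟨x₂, hx₂, z', hz', h₂, e, rfl⟩ := State.rest_adj_of_mapBy hadj hf hx hz hxz
    rw [initialState_rest] at hx₁ hy' hx₂ hz'
    have hx := (hm.eq_iff ⟨x₂, hx₂⟩ ⟨x₁, hx₁⟩).1 e
    have h₁' : (outside G v₀).Adj ⟨x₁, hx₁⟩ ⟨y', hy'⟩ := h₁
    have h₂' : (outside G v₀).Adj ⟨x₂, hx₂⟩ ⟨z', hz'⟩ := h₂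
    refine absurd ((hm.eq_iff ⟨y', hy'⟩ ⟨z', hz'⟩).2
      ⟨h₁'.reachable.symm.trans (hx.1.symm.trans h₂'.reachable), ?_⟩) hyz
    have := c.valid h₁'
    have := c.valid h₂'
    have := hx.2
    cases h : c ⟨x₁, hx₁⟩ <;> cases h' : c ⟨y', hy'⟩ <;> cases h'' : c ⟨z', hz'⟩ <;> simp_all
  · obtain ⟨χ, hχ, hr, hrb⟩ := exists_red_blue_coloring hi hG ha h3
    have hχm : ∀ x, χ (m x) = χ x := by
      intro x
      by_cases hx : x ∈ closedNbhd G v₀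
      · rw [hm.1 x hx]
      · obtain ⟨y, hy, hreach, hc⟩ := hm.2.1 ⟨x, hx⟩
        simp only at hy
        rw [hy]
        exact ((coloring_eq_iff hχ hrb hreach).1 hc).symm
    refine ⟨χ, fun x y hxy => ?_, (hχm v₀).trans hr, fun x hx => ?_⟩
    · obtain ⟨x', y', h, rfl, rfl⟩ := (State.mapBy_adj hf).1 hxy
      rw [hχm, hχm]
      exact hχ _ _ h
    · obtain ⟨x', -, rfl⟩ := (State.mem_rest.1 hx).1
      have := State.mem_rest_of_mapBy hf (Set.mem_univ x') hx
      rw [initialState_rest] at this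
      rw [hχm]
      exact hrb x' this

end

theorem nonempty_coloring_bool {H : SimpleGraph V} (h : H.Colorable 2) :
    Nonempty (H.Coloring Bool) :=
  h.elim fun c => ⟨SimpleGraph.Coloring.mk (fun x => finTwoEquiv (c x))
    fun {x y} hxy => finTwoEquiv.injective.ne (c.valid (v := x) (w := y) hxy)⟩

theorem exists_isMerging (c : (outside G v₀).Coloring Bool) : ∃ m, IsMerging G v₀ c m := by
  classical
  let r : Setoid ↥(closedNbhd G v₀)ᶜ :=
    { r := fun x y => (outside G v₀).Reachable x y ∧ c x = c y
      iseqv := ⟨fun x => ⟨.refl x, rfl⟩, fun h => ⟨h.1.symm, h.2.symm⟩,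
        fun h h' => ⟨h.1.trans h'.1, h.2.trans h'.2⟩⟩ }
  refine ⟨fun x => if h : x ∈ closedNbhd G v₀ then x else (Quotient.mk r ⟨x, h⟩).out,
    fun x hx => dif_pos hx, fun x => ?_, fun x y h h' => ?_⟩
  · refine ⟨(Quotient.mk r x).out, dif_neg x.2, ?_⟩
    exact Setoid.symm (Quotient.mk_out (s := r) x)
  · simp only
    rw [dif_neg x.2, dif_neg y.2]
    have : Quotient.mk r x = Quotient.mk r y := Quotient.sound ⟨h, h'⟩
    rw [this]

end Merging

/-! ### The structure of a final state -/

section Final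

variable {V : Type*}

/-- The sets `{u i, w i}` are the components of the subgraph of `H` induced by `A`. -/
structure ListsMatching (H : SimpleGraph V) (A : Set V) {k : ℕ} (u w : Fin k → V) : Prop where
  adj : ∀ i, H.Adj (u i) (w i)
  injective : Function.Injective (Sum.elim u w)
  range : Set.range (Sum.elim u w) = A
  edge : ∀ x ∈ A, ∀ y ∈ A, H.Adj x y → ∃ i, x = u i ∧ y = w i ∨ x = w i ∧ y = u i

namespace ListsMatching

variable {H : SimpleGraph V} {A : Set V} {k : ℕ} {u w : Fin k → V}

theorem left_mem (h : ListsMatching H A u w) (i : Fin k) : u i ∈ A :=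
  h.range ▸ ⟨Sum.inl i, rfl⟩

theorem right_mem (h : ListsMatching H A u w) (i : Fin k) : w i ∈ A :=
  h.range ▸ ⟨Sum.inr i, rfl⟩

theorem exists_eq (h : ListsMatching H A u w) {x : V} (hx : x ∈ A) : ∃ i, x = u i ∨ x = w i := by
  rw [← h.range] at hx
  obtain ⟨i | i, rfl⟩ := hx
  exacts [⟨i, Or.inl rfl⟩, ⟨i, Or.inr rfl⟩]

theorem left_injective (h : ListsMatching H A u w) {i j : Fin k} (e : u i = u j) : i = j :=
  Sum.inl_injective (h.injective (a₁ := Sum.inl i) (a₂ := Sum.inl j) e)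

theorem right_injective (h : ListsMatching H A u w) {i j : Fin k} (e : w i = w j) : i = j :=
  Sum.inr_injective (h.injective (a₁ := Sum.inr i) (a₂ := Sum.inr j) e)

theorem left_ne_right (h : ListsMatching H A u w) (i j : Fin k) : u i ≠ w j := fun e =>
  absurd (h.injective (a₁ := Sum.inl i) (a₂ := Sum.inr j) e) (by simp)

end ListsMatching

/-- Every vertex of `A` has exactly one neighbor in `A`. -/
def IsMatched (H : SimpleGraph V) (A : Set V) : Prop := ∀ x ∈ A, ∃! y, y ∈ A ∧ H.Adj x y

theorem listsMatching_of_components {H : SimpleGraph V} {A : Set V} (hA : IsMatched H A) {k : ℕ}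
    {u w : Fin k → V} (hne : ∀ i, u i ≠ w i) (e : Fin k ≃ (H.induce A).ConnectedComponent)
    (he : ∀ i, Subtype.val '' (e i).supp = {u i, w i}) : ListsMatching H A u w := by
  have mem : ∀ i, ∀ x : V, (x = u i ∨ x = w i) ↔
      ∃ hx : x ∈ A, (H.induce A).connectedComponentMk ⟨x, hx⟩ = e i := by
    intro i x
    have : x ∈ Subtype.val '' (e i).supp ↔ x ∈ ({u i, w i} : Set V) := by rw [he]
    rw [Set.mem_insert_iff, Set.mem_singleton_iff] at this
    rw [← this]
    simp
  have hu : ∀ i, ∃ hx : u i ∈ A, (H.induce A).connectedComponentMk ⟨u i, hx⟩ = e i :=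
    fun i => (mem i _).1 (Or.inl rfl)
  have hw : ∀ i, ∃ hx : w i ∈ A, (H.induce A).connectedComponentMk ⟨w i, hx⟩ = e i :=
    fun i => (mem i _).1 (Or.inr rfl)
  have same : ∀ i j x, (x = u i ∨ x = w i) → (x = u j ∨ x = w j) → i = j := by
    intro i j x hi hj
    obtain ⟨h₁, h₂⟩ := (mem i x).1 hi
    obtain ⟨h₃, h₄⟩ := (mem j x).1 hj
    exact e.injective (h₂.symm.trans h₄)
  have edge : ∀ x ∈ A, ∀ y ∈ A, H.Adj x y → ∃ i, x = u i ∧ y = w i ∨ x = w i ∧ y = u i := by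
    intro x hx y hy hxy
    obtain ⟨i, hi⟩ := e.surjective ((H.induce A).connectedComponentMk ⟨x, hx⟩)
    have hadj : (H.induce A).Adj ⟨x, hx⟩ ⟨y, hy⟩ := hxy
    have h₁ := (mem i x).2 ⟨hx, hi.symm⟩
    have h₂ := (mem i y).2 ⟨hy,
      (SimpleGraph.ConnectedComponent.sound hadj.reachable.symm).trans hi.symm⟩
    refine ⟨i, ?_⟩
    rcases h₁ with h₁ | h₁ <;> rcases h₂ with h₂ | h₂
    · exact absurd (h₁.trans h₂.symm) hxy.ne
    · exact Or.inl ⟨h₁, h₂⟩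
    · exact Or.inr ⟨h₁, h₂⟩
    · exact absurd (h₁.trans h₂.symm) hxy.ne
  refine ⟨fun i => ?_, ?_, ?_, edge⟩
  · obtain ⟨y, ⟨hy, hadj⟩, -⟩ := hA _ (hu i).1
    obtain ⟨j, ⟨h₁, h₂⟩ | ⟨h₁, h₂⟩⟩ := edge _ (hu i).1 y hy hadj
    · have := same i j (u i) (Or.inl rfl) (Or.inl h₁)
      subst this
      exact h₂ ▸ hadj
    · have := same i j (u i) (Or.inl rfl) (Or.inr h₁)
      subst this
      exact absurd h₁ (hne i)
  · rintro (i | i) (j | j) h <;> simp only [Sum.elim_inl, Sum.elim_inr] at h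
    · rw [same i j (u i) (Or.inl rfl) (Or.inl h)]
    · have := same i j (u i) (Or.inl rfl) (Or.inr h)
      subst this
      exact absurd h (hne i)
    · have := same i j (w i) (Or.inr rfl) (Or.inl h)
      subst this
      exact absurd h.symm (hne i)
    · rw [same i j (w i) (Or.inr rfl) (Or.inr h)]
  · ext x
    constructor
    · rintro ⟨i | i, rfl⟩
      exacts [(hu i).1, (hw i).1]
    · intro hx
      obtain ⟨i, hi⟩ := e.surjective ((H.induce A).connectedComponentMk ⟨x, hx⟩)
      rcases (mem i x).2 ⟨hx, hi.symm⟩ with h | h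
      exacts [⟨Sum.inl i, h.symm⟩, ⟨Sum.inr i, h.symm⟩]

theorem supp_eq_of_isMatched {H : SimpleGraph V} {A : Set V} (hA : IsMatched H A) {x y : V}
    (hx : x ∈ A) (hy : y ∈ A) (hxy : H.Adj x y) :
    Subtype.val '' ((H.induce A).connectedComponentMk ⟨x, hx⟩).supp = {x, y} := by
  have key : ∀ z, (H.induce A).Reachable ⟨x, hx⟩ z → (z : V) = x ∨ (z : V) = y := by
    intro z hz
    rw [SimpleGraph.reachable_iff_reflTransGen] at hz
    induction hz with
    | refl => exact Or.inl rfl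
    | @tail a b _ hab ih =>
      have hab' : H.Adj a b := hab
      rcases ih with h | h
      · rw [h] at hab'
        exact Or.inr ((hA x hx).unique ⟨b.2, hab'⟩ ⟨hy, hxy⟩)
      · rw [h] at hab'
        exact Or.inl ((hA y hy).unique ⟨b.2, hab'⟩ ⟨hx, hxy.symm⟩)
  have hadj : (H.induce A).Adj ⟨x, hx⟩ ⟨y, hy⟩ := hxy
  ext z
  constructor
  · rintro ⟨z, hz, rfl⟩
    exact key z (SimpleGraph.ConnectedComponent.exact hz).symm
  · rintro (rfl | rfl)
    · exact ⟨⟨z, hx⟩, rfl, rfl⟩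
    · exact ⟨⟨z, hy⟩, SimpleGraph.ConnectedComponent.sound hadj.reachable.symm, rfl⟩

/-- The predicate `Q` selects which end of each matching edge is listed first; it is later taken to
be blueness. -/
theorem exists_lists [Finite V] {H : SimpleGraph V} {A : Set V} (hA : IsMatched H A)
    (Q : V → Prop) (hQ : ∀ x ∈ A, ∀ y ∈ A, H.Adj x y → Q x ∨ Q y) :
    ∃ (k : ℕ) (u w : Fin k → V), (∀ i, u i ≠ w i) ∧ (∀ i, Q (u i)) ∧
      ∃ e : Fin k ≃ (H.induce A).ConnectedComponent,
        ∀ i, Subtype.val '' (e i).supp = {u i, w i} := by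
  have hC : ∀ C : (H.induce A).ConnectedComponent, ∃ x y, x ≠ y ∧ Q x ∧
      Subtype.val '' C.supp = {x, y} := by
    intro C
    obtain ⟨⟨x, hx⟩, rfl⟩ := C.exists_rep
    obtain ⟨y, ⟨hy, hxy⟩, -⟩ := hA x hx
    have h := supp_eq_of_isMatched hA hx hy hxy
    rcases hQ x hx y hy hxy with h' | h'
    · exact ⟨x, y, hxy.ne, h', h⟩
    · exact ⟨y, x, hxy.ne', h', h.trans (Set.pair_comm x y)⟩
  choose x y hne hq hs using hC
  obtain ⟨k, ⟨e⟩⟩ := Finite.exists_equiv_fin (H.induce A).ConnectedComponent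
  exact ⟨k, fun i => x (e.symm i), fun i => y (e.symm i), fun i => hne _, fun i => hq _, e.symm,
    fun i => hs _⟩

theorem State.mem_rest_or {s : State V} {x : V} (hx : x ∈ s.verts) :
    x = s.root ∨ x ∈ s.nbhd ∨ x ∈ s.rest := by
  rw [State.mem_rest]; tauto

theorem State.mem_paired {s : State V} {x : V} :
    x ∈ s.paired ↔ x ∈ s.nbhd ∧ ∃ a ∈ s.nbhd, s.graph.Adj x a := by
  simp only [State.paired, State.isolated, Set.mem_sdiff, Set.mem_ofPred_eq]
  push Not
  constructor
  · exact fun h => ⟨h.1, h.2 h.1⟩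
  · exact fun h => ⟨h.1, fun _ => h.2⟩

/-- A state at the end of the reduction loop. -/
structure State.IsFinal (G : SimpleGraph V) (s : State V) : Prop extends s.Invariant G where
  cliqueFree : s.graph.CliqueFree 4
  irreducible : ∀ a b, ¬ s.Candidate a b

theorem not_cliqueFree_four {H : SimpleGraph V} :
    ¬ H.CliqueFree 4 ↔ ∃ a b c d, H.Adj a b ∧ H.Adj a c ∧ H.Adj a d ∧ H.Adj b c ∧ H.Adj b d ∧
      H.Adj c d := by
  classical
  rw [SimpleGraph.CliqueFree]
  push Not
  constructor
  · rintro ⟨t, ht⟩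
    obtain ⟨a, b, c, d, hab, hac, had, hbc, hbd, hcd, rfl⟩ :=
      Finset.card_eq_four.1 ht.card_eq
    have := ht.isClique
    exact ⟨a, b, c, d, this (by simp) (by simp) hab, this (by simp) (by simp) hac,
      this (by simp) (by simp) had, this (by simp) (by simp) hbc, this (by simp) (by simp) hbd,
      this (by simp) (by simp) hcd⟩
  · rintro ⟨a, b, c, d, hab, hac, had, hbc, hbd, hcd⟩
    refine ⟨{a, b, c, d}, ?_⟩
    rw [SimpleGraph.isNClique_iff]
    refine ⟨?_, Finset.card_eq_four.2 ⟨a, b, c, d, hab.ne, hac.ne, had.ne, hbc.ne, hbd.ne, hcd.ne,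
      rfl⟩⟩
    intro x hx y hy hxy
    simp only [Finset.coe_insert, Finset.coe_singleton, Set.mem_insert_iff,
      Set.mem_singleton_iff] at hx hy
    rcases hx with rfl | rfl | rfl | rfl <;> rcases hy with rfl | rfl | rfl | rfl <;>
      first | exact absurd rfl hxy | assumption | (apply SimpleGraph.Adj.symm; assumption)

namespace State.IsFinal

variable {G : SimpleGraph V} {s : State V}

/-- Two different common neighbors of an edge would give a `K₄` if adjacent and a diamond otherwise.
-/
theorem eq_of_triangles (h : s.IsFinal G) {c d x y : V} (hcd : s.graph.Adj c d)
    (hxc : s.graph.Adj x c) (hxd : s.graph.Adj x d) (hyc : s.graph.Adj y c)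
    (hyd : s.graph.Adj y d) : x = y := by
  by_contra hne
  by_cases hxy : s.graph.Adj x y
  · exact not_cliqueFree_four.2 ⟨x, y, c, d, hxy, hxc, hxd, hyc, hyd, hcd⟩ h.cliqueFree
  · exact h.irreducible x y (Or.inl ⟨c, d, hne, hxy, hxc, hxd, hyc, hyd, hcd⟩)

theorem not_fan (h : s.IsFinal G) {x : V} (hx : x ∈ s.rest) : ¬ s.Fan x := by
  rintro ⟨c, hc, d, hd, hcd, hxc, hxd⟩
  exact (mem_rest.1 hx).2.1 (h.eq_of_triangles hcd hxc hxd hc hd)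

theorem nbhd_unique (h : s.IsFinal G) {z a b : V} (hz : z ∈ s.nbhd) (ha : a ∈ s.nbhd)
    (hb : b ∈ s.nbhd) (hza : s.graph.Adj z a) (hzb : s.graph.Adj z b) : a = b :=
  h.eq_of_triangles (c := s.root) (d := z) hz (SimpleGraph.Adj.symm ha) hza.symm
    (SimpleGraph.Adj.symm hb) hzb.symm

/-- A neighbor in `rest` exists because otherwise `N(x) ⊆ N(root)` and R2 would apply. It is unique
by thinness, since a fan and the root would be two common neighbors of one edge. -/
theorem isMatched_rest (h : s.IsFinal G) : IsMatched s.graph s.rest := by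
  intro x hx
  have hx' := mem_rest.1 hx
  obtain ⟨y, hxy, hy⟩ : ∃ y, s.graph.Adj x y ∧ y ∉ s.nbhd := by
    by_contra! hcon
    exact h.irreducible x s.root (Or.inr ⟨hx'.1, h.root_mem, hx'.2.1, fun y hy => hcon y hy⟩)
  have hyr : y ∈ s.rest := by
    refine mem_rest.2 ⟨h.adjMem _ _ hxy.symm, ?_, hy⟩
    rintro rfl
    exact hx'.2.2 hxy.symm
  refine ⟨y, ⟨hyr, hxy⟩, fun z ⟨hz, hxz⟩ => ?_⟩
  by_contra hne
  exact h.not_fan hx (h.thin x hx z hz y hyr hxz hxy hne)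

theorem isMatched_paired (h : s.IsFinal G) : IsMatched s.graph s.paired := by
  intro x hx
  obtain ⟨hx', a, ha, hxa⟩ := mem_paired.1 hx
  exact ⟨a, ⟨mem_paired.2 ⟨ha, x, hx', hxa.symm⟩, hxa⟩,
    fun b hb => h.nbhd_unique hx' (mem_paired.1 hb.1).1 ha hb.2 hxa⟩

/-- Adjacency to both ends would make `x` a fan. If `x` were adjacent to neither, diameter 2 would
provide connecting vertices to `z` and to `z'`. -/
theorem adj_iff_not_adj (h : s.IsFinal G) {x z z' : V} (hx : x ∈ s.rest) (hz : z ∈ s.nbhd)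
    (hz' : z' ∈ s.nbhd) (hzz' : s.graph.Adj z z') : s.graph.Adj x z' ↔ ¬ s.graph.Adj x z := by
  refine ⟨fun h₁ h₂ => h.not_fan hx ⟨z, hz, z', hz', hzz', h₂, h₁⟩, fun h₁ => ?_⟩
  by_contra h₂
  -- The connecting vertex is not in the neighborhood of the root, where `b` is the only neighbor of
  -- `a`. So it is the unique partner of `x` in `rest`; being adjacent to both `z` and `z'`, that
  -- partner is a fan.
  have key : ∀ a b, a ∈ s.nbhd → b ∈ s.nbhd → s.graph.Adj a b → ¬ s.graph.Adj x a →
      ¬ s.graph.Adj x b → ∃ y ∈ s.rest, s.graph.Adj x y ∧ s.graph.Adj y a := by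
    intro a b ha hb hab hxa hxb
    rcases h.diam x (mem_rest.1 hx).1 a (h.adjMem _ _ (SimpleGraph.Adj.symm ha)) with
      e | e | ⟨t, ht₁, ht₂⟩
    · exact absurd (e ▸ ha) (mem_rest.1 hx).2.2
    · exact absurd e hxa
    · refine ⟨t, mem_rest.2 ⟨h.adjMem _ _ ht₂, ?_, fun ht => ?_⟩, ht₁, ht₂⟩
      · rintro rfl
        exact (mem_rest.1 hx).2.2 ht₁.symm
      · exact hxb (h.nbhd_unique ha hb ht hab ht₂.symm ▸ ht₁)
  obtain ⟨y, hy, hxy, hyz⟩ := key z z' hz hz' hzz' h₁ h₂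
  obtain ⟨y', hy', hxy', hyz'⟩ := key z' z hz' hz hzz'.symm h₂ h₁
  have := (h.isMatched_rest x hx).unique ⟨hy', hxy'⟩ ⟨hy, hxy⟩
  subst this
  exact h.not_fan hy ⟨z, hz, z', hz', hzz', hyz, hyz'⟩

theorem listsMatching (h : s.IsFinal G) {k : ℕ} {u w : Fin k → V} (hC : ListsComponents s u w) :
    ListsMatching s.graph s.rest u w := by
  obtain ⟨hne, e, he⟩ := hC
  exact listsMatching_of_components h.isMatched_rest hne e he

theorem exists_listsComponents [Finite V] (h : s.IsFinal G) (Q : V → Prop)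
    (hQ : ∀ x ∈ s.rest, ∀ y ∈ s.rest, s.graph.Adj x y → Q x ∨ Q y) :
    ∃ (k : ℕ) (u w : Fin k → V), ListsComponents s u w ∧ ∀ i, Q (u i) := by
  obtain ⟨k, u, w, hne, hq, he⟩ := exists_lists h.isMatched_rest Q hQ
  exact ⟨k, u, w, ⟨hne, he⟩, hq⟩

theorem exists_listsPairs [Finite V] (h : s.IsFinal G) :
    ∃ (q : ℕ) (z z' : Fin q → V), ListsPairs s z z' := by
  obtain ⟨k, u, w, hne, -, e, he⟩ := exists_lists h.isMatched_paired (fun _ => True)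
    (fun _ _ _ _ _ => Or.inl trivial)
  have := listsMatching_of_components h.isMatched_paired hne e he
  exact ⟨k, u, w, this.adj, this.injective, this.range⟩

theorem listsMatching_pairs (h : s.IsFinal G) {q : ℕ} {z z' : Fin q → V} (hZ : ListsPairs s z z') :
    ListsMatching s.graph s.paired z z' := by
  obtain ⟨hadj, hinj, hrange⟩ := hZ
  refine ⟨hadj, hinj, hrange, fun x hx y hy hxy => ?_⟩
  have hm : ∀ j, z j ∈ s.paired ∧ z' j ∈ s.paired :=
    fun j => ⟨hrange ▸ ⟨Sum.inl j, rfl⟩, hrange ▸ ⟨Sum.inr j, rfl⟩⟩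
  have hx' := hx
  rw [← hrange] at hx'
  obtain ⟨j | j, rfl⟩ := hx'
  · exact ⟨j, Or.inl ⟨rfl, (h.isMatched_paired _ hx).unique ⟨hy, hxy⟩ ⟨(hm j).2, hadj j⟩⟩⟩
  · exact ⟨j, Or.inr ⟨rfl, (h.isMatched_paired _ hx).unique ⟨hy, hxy⟩ ⟨(hm j).1, (hadj j).symm⟩⟩⟩

end State.IsFinal

end Final

/-! ### Correctness of the 2SAT stage -/

section Correctness

variable {V : Type*} {G : SimpleGraph V} {s : State V}

/-- Whichever of `u i`, `w i` is blue decides the pair: `z j` is blue exactly when it is not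
adjacent to that vertex. -/
theorem satisfies_formula_iff {k q : ℕ} {u w : Fin k → V} {z : Fin q → V}
    {τ : Fin k ⊕ Fin q → Bool} :
    Satisfies τ (formula s u w z) ↔ ∀ i j,
      (τ (.inl i) = true ∨ (τ (.inr j) = true ↔ ¬ s.graph.Adj (u i) (z j))) ∧
      (τ (.inl i) = false ∨ (τ (.inr j) = true ↔ ¬ s.graph.Adj (w i) (z j))) := by
  have hb : ∀ (p : Prop) [Decidable p] (b : Bool),
      b = (if p then false else true) ↔ (b = true ↔ ¬ p) := by
    intro p _ b
    by_cases hp : p <;> cases b <;> simp [hp]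
  constructor
  · intro h i j
    have h₁ := h _ ⟨i, j, Or.inl rfl⟩
    have h₂ := h _ ⟨i, j, Or.inr rfl⟩
    simp only [hb] at h₁ h₂
    exact ⟨h₁, h₂⟩
  · rintro h C ⟨i, j, rfl | rfl⟩
    · simp only [hb]
      exact (h i j).1
    · simp only [hb]
      exact (h i j).2

/-- Color a set of vertices blue, the other neighbors of the root green, and the other vertices
red. -/
noncomputable def State.paint (s : State V) (B : Set V) : V → Color :=
  open Classical in fun x => if x ∈ B then .blue else if x ∈ s.nbhd then .green else .red

theorem State.paint_of_mem {B : Set V} {x : V} (h : x ∈ B) : s.paint B x = .blue := if_pos h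

theorem State.paint_of_mem_nbhd {B : Set V} {x : V} (h : x ∉ B) (h' : x ∈ s.nbhd) :
    s.paint B x = .green := (if_neg h).trans (if_pos h')

theorem State.paint_of_notMem_nbhd {B : Set V} {x : V} (h : x ∉ B) (h' : x ∉ s.nbhd) :
    s.paint B x = .red := (if_neg h).trans (if_neg h')

theorem State.root_notMem_nbhd : s.root ∉ s.nbhd := s.graph.loopless.irrefl _

theorem State.nbhd_eq : s.nbhd = s.isolated ∪ s.paired := by
  rw [State.paired, Set.union_sdiff_self, Set.union_eq_self_of_subset_left fun x hx => hx.1]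

theorem State.AdjMem.proper (hs : s.AdjMem) {χ : V → Color} (hroot : χ s.root = .red)
    (hN : ∀ a ∈ s.nbhd, χ a ≠ .red)
    (hNN : ∀ a ∈ s.nbhd, ∀ b ∈ s.nbhd, s.graph.Adj a b → χ a ≠ χ b)
    (hRR : ∀ a ∈ s.rest, ∀ b ∈ s.rest, s.graph.Adj a b → χ a ≠ χ b)
    (hNR : ∀ a ∈ s.nbhd, ∀ b ∈ s.rest, s.graph.Adj a b → χ a ≠ χ b) {x y : V}
    (h : s.graph.Adj x y) : χ x ≠ χ y := by
  have hr : ∀ y, s.graph.Adj s.root y → χ s.root ≠ χ y := fun y hy => by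
    rw [hroot]; exact (hN y hy).symm
  rcases State.mem_rest_or (hs x y h) with rfl | hx | hx
  · exact hr _ h
  · rcases State.mem_rest_or (hs y x h.symm) with rfl | hy | hy
    · exact (hr _ h.symm).symm
    · exact hNN x hx y hy h
    · exact hNR x hx y hy h
  · rcases State.mem_rest_or (hs y x h.symm) with rfl | hy | hy
    · exact (hr _ h.symm).symm
    · exact (hNR y hy x hx h.symm).symm
    · exact hRR x hx y hy h

namespace State.IsFinal

theorem proper_of_finish (h : s.IsFinal G) {χ : V → Color} (hF : Finish s (some χ)) {x y : V}
    (hxy : s.graph.Adj x y) : χ x ≠ χ y := by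
  generalize ho : some χ = o at hF
  cases hF with
  | noRest χ hR hroot hN hproper =>
    obtain rfl := Option.some.inj ho
    refine h.adjMem.proper hroot (fun a ha => ?_) hproper ?_ ?_ hxy
    · rcases hN a ha with e | e <;> simp [e]
    · simp [hR]
    · simp [hR]
  | noPairs χ u w hR hC hP hroot hN huw =>
    obtain rfl := Option.some.inj ho
    have hL := h.listsMatching hC
    refine h.adjMem.proper hroot (fun a ha => ?_) (fun a ha b hb hab => ?_)
      (fun a ha b hb hab => ?_) (fun a ha b hb hab => ?_) hxy
    · simp [hN a ha]
    · have : a ∈ s.paired := mem_paired.2 ⟨ha, b, hb, hab⟩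
      simp [hP] at this
    · obtain ⟨i, ⟨rfl, rfl⟩ | ⟨rfl, rfl⟩⟩ := hL.edge a ha b hb hab <;> simp [huw i]
    · obtain ⟨i, rfl | rfl⟩ := hL.exists_eq hb <;> simp [huw i, hN a ha]
  | unsat => exact absurd ho (by simp)
  | sat χ u w z z' hR hC hP hZ τ hτ hroot hN huw hz =>
    obtain rfl := Option.some.inj ho
    have hL := h.listsMatching hC
    have hL' := h.listsMatching_pairs hZ
    rw [satisfies_formula_iff] at hτ
    have hm : ∀ j, z j ∈ s.nbhd ∧ z' j ∈ s.nbhd :=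
      fun j => ⟨(mem_paired.1 (hL'.left_mem j)).1, (mem_paired.1 (hL'.right_mem j)).1⟩
    refine h.adjMem.proper hroot (fun a ha => ?_) (fun a ha b hb hab => ?_)
      (fun a ha b hb hab => ?_) (fun a ha b hb hab => ?_) hxy
    · rw [State.nbhd_eq] at ha
      rcases ha with ha | ha
      · simp [hN a ha]
      · obtain ⟨j, rfl | rfl⟩ := hL'.exists_eq ha <;> have := hz j <;> split_ifs at this <;>
          simp [this]
    · obtain ⟨j, ⟨rfl, rfl⟩ | ⟨rfl, rfl⟩⟩ := hL'.edge a (mem_paired.2 ⟨ha, b, hb, hab⟩) b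
        (mem_paired.2 ⟨hb, a, ha, hab.symm⟩) hab <;> have := hz j <;> split_ifs at this <;>
          simp [this]
    · obtain ⟨i, ⟨rfl, rfl⟩ | ⟨rfl, rfl⟩⟩ := hL.edge a ha b hb hab <;> have := huw i <;>
        split_ifs at this <;> simp [this]
    · rw [State.nbhd_eq] at ha
      rcases ha with ha | ha
      · obtain ⟨i, rfl | rfl⟩ := hL.exists_eq hb <;> have := huw i <;> split_ifs at this <;>
          simp [this, hN a ha]
      · obtain ⟨j, hj⟩ := hL'.exists_eq ha
        obtain ⟨i, hi⟩ := hL.exists_eq hb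
        have h₁ := hτ i j
        have h₂ := huw i
        have h₃ := hz j
        have hu := h.adj_iff_not_adj (hL.left_mem i) (hm j).1 (hm j).2 (hL'.adj j)
        have hw := h.adj_iff_not_adj (hL.right_mem i) (hm j).1 (hm j).2 (hL'.adj j)
        have hab' := hab.symm
        rcases hj with rfl | rfl <;> rcases hi with rfl | rfl <;>
          cases hi : τ (.inl i) <;> cases hj : τ (.inr j) <;> simp_all

/-- A blue vertex `x` of `rest` is adjacent to exactly one of `z j`, `z' j`; that one must be green,
being adjacent to `x` and the root, and the other blue. The colors of the isolated vertices play no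
role. -/
theorem exists_satisfies (h : s.IsFinal G) {χ : V → Color} (hχ : s.IsGood χ) {k q : ℕ}
    {u w : Fin k → V} {z z' : Fin q → V} (hC : ListsComponents s u w) (hZ : ListsPairs s z z') :
    Satisfies (Sum.elim (fun i => decide (χ (u i) = .red)) (fun j => decide (χ (z j) = .blue)))
      (formula s u w z) := by
  have hL := h.listsMatching hC
  have hL' := h.listsMatching_pairs hZ
  have hm : ∀ j, z j ∈ s.nbhd ∧ z' j ∈ s.nbhd :=
    fun j => ⟨(mem_paired.1 (hL'.left_mem j)).1, (mem_paired.1 (hL'.right_mem j)).1⟩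
  have key : ∀ x ∈ s.rest, χ x = .blue → ∀ j, χ (z j) = .blue ↔ ¬ s.graph.Adj x (z j) := by
    intro x hx hxb j
    constructor
    · intro hb hadj
      exact hχ.proper _ _ hadj (hxb.trans hb.symm)
    · intro hadj
      have h₁ := hχ.proper _ _ ((h.adj_iff_not_adj hx (hm j).1 (hm j).2 (hL'.adj j)).2 hadj)
      have h₂ := hχ.proper _ _ (hL'.adj j)
      have h₃ := hχ.proper _ _ (hm j).1
      have h₄ := hχ.proper _ _ (hm j).2
      rw [hχ.root] at h₃ h₄
      cases hz : χ (z j) <;> cases hz' : χ (z' j) <;> simp_all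
  rw [satisfies_formula_iff]
  intro i j
  simp only [Sum.elim_inl, Sum.elim_inr, decide_eq_true_eq, decide_eq_false_iff_not]
  have h₁ := hχ.rest _ (hL.left_mem i)
  have h₂ := hχ.rest _ (hL.right_mem i)
  have h₃ := hχ.proper _ _ (hL.adj i)
  rcases h₁ with h₁ | h₁
  · refine ⟨Or.inl h₁, Or.inr (key _ (hL.right_mem i) ?_ j)⟩
    rcases h₂ with h₂ | h₂
    · exact absurd (h₁.trans h₂.symm) h₃
    · exact h₂
  · exact ⟨Or.inr (key _ (hL.left_mem i) h₁ j), Or.inl (by simp [h₁])⟩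

theorem not_colorable_of_finish (h : s.IsFinal G) (hF : Finish s none) : ¬ G.Colorable 3 := by
  intro h3
  obtain ⟨χ, hχ⟩ := h.good h3
  cases hF with
  | unsat u w z z' hR hC hP hZ hφ => exact hφ ⟨_, h.exists_satisfies hχ hC hZ⟩

/-- Every suitable coloring of the final graph is found by the last part of the algorithm. -/
theorem finish_of_isGood [Finite V] (h : s.IsFinal G) {χ : V → Color} (hχ : s.IsGood χ)
    (hR : s.rest ≠ ∅) (hN : ∀ a ∈ s.isolated, χ a = .green) : Finish s (some χ) := by
  -- The blue end of each component is listed first, as the branch without pairs prescribes.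
  obtain ⟨k, u, w, hC, hu⟩ := h.exists_listsComponents (fun x => χ x = .blue) (by
    intro x hx y hy hxy
    have := hχ.proper _ _ hxy
    rcases hχ.rest x hx with e | e <;> rcases hχ.rest y hy with e' | e' <;> simp_all)
  have hL := h.listsMatching hC
  by_cases hP : s.paired = ∅
  · refine .noPairs χ u w hR hC hP hχ.root (fun a ha => hN a ?_) fun i => ⟨hu i, ?_⟩
    · rwa [State.nbhd_eq, hP, Set.union_empty] at ha
    · have := hχ.proper _ _ (hL.adj i)
      rcases hχ.rest _ (hL.right_mem i) with e | e
      · exact e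
      · exact absurd ((hu i).trans e.symm) this
  · obtain ⟨q, z, z', hZ⟩ := h.exists_listsPairs
    have hL' := h.listsMatching_pairs hZ
    refine .sat χ u w z z' hR hC hP hZ _ (h.exists_satisfies hχ hC hZ) hχ.root hN (fun i => ?_)
      fun j => ?_
    · have h₁ := hχ.proper _ _ (hL.adj i)
      have h₂ := hχ.rest _ (hL.left_mem i)
      have h₃ := hχ.rest _ (hL.right_mem i)
      rcases h₂ with h₂ | h₂ <;> rcases h₃ with h₃ | h₃ <;> simp_all
    · have h₁ := hχ.proper _ _ (hL'.adj j)
      have h₂ := hχ.proper s.root (z j) (mem_paired.1 (hL'.left_mem j)).1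
      have h₃ := hχ.proper s.root (z' j) (mem_paired.1 (hL'.right_mem j)).1
      rw [hχ.root] at h₂ h₃
      cases e₁ : χ (z j) <;> cases e₂ : χ (z' j) <;> simp_all

theorem exists_finish [Finite V] (h : s.IsFinal G) : ∃ out, Finish s out := by
  obtain ⟨q, z, z', hZ⟩ := h.exists_listsPairs
  have hL' := h.listsMatching_pairs hZ
  have hz : ∀ j, z j ∈ s.nbhd := fun j => (mem_paired.1 (hL'.left_mem j)).1
  have hz' : ∀ j, z' j ∈ s.nbhd := fun j => (mem_paired.1 (hL'.right_mem j)).1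
  by_cases hR : s.rest = ∅
  · have hB : ∀ x, x ∈ Set.range z → x ∈ s.nbhd := by
      rintro _ ⟨j, rfl⟩
      exact hz j
    have hzB' : ∀ j, s.paint (Set.range z) (z' j) = .green :=
      fun j => paint_of_mem_nbhd (by rintro ⟨i, hi⟩; exact hL'.left_ne_right i j hi) (hz' j)
    have hzB : ∀ j, s.paint (Set.range z) (z j) = .blue := fun j => paint_of_mem ⟨j, rfl⟩
    refine ⟨_, .noRest (s.paint (Set.range z)) hR
      (paint_of_notMem_nbhd (fun h' => root_notMem_nbhd (hB _ h')) root_notMem_nbhd)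
      (fun a ha => ?_) (fun a ha b hb hab => ?_)⟩
    · by_cases h' : a ∈ Set.range z
      · exact Or.inl (paint_of_mem h')
      · exact Or.inr (paint_of_mem_nbhd h' ha)
    · obtain ⟨j, ⟨rfl, rfl⟩ | ⟨rfl, rfl⟩⟩ := hL'.edge a (mem_paired.2 ⟨ha, b, hb, hab⟩) b
        (mem_paired.2 ⟨hb, a, ha, hab.symm⟩) hab <;> simp [hzB, hzB']
  obtain ⟨k, u, w, hC, -⟩ := h.exists_listsComponents (fun _ => True)
    (fun _ _ _ _ _ => Or.inl trivial)
  have hL := h.listsMatching hC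
  have hu : ∀ i, u i ∉ s.nbhd := fun i => (mem_rest.1 (hL.left_mem i)).2.2
  have hw : ∀ i, w i ∉ s.nbhd := fun i => (mem_rest.1 (hL.right_mem i)).2.2
  by_cases hP : s.paired = ∅
  · have hB : ∀ x, x ∈ Set.range u → x ∈ s.rest := by
      rintro _ ⟨j, rfl⟩
      exact hL.left_mem j
    refine ⟨_, .noPairs (s.paint (Set.range u)) u w hR hC hP
      (paint_of_notMem_nbhd (fun h' => (mem_rest.1 (hB _ h')).2.1 rfl) root_notMem_nbhd)
      (fun a ha => paint_of_mem_nbhd (fun h' => (mem_rest.1 (hB _ h')).2.2 ha) ha)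
      (fun i => ⟨paint_of_mem ⟨i, rfl⟩, paint_of_notMem_nbhd ?_ (hw i)⟩)⟩
    rintro ⟨j, hj⟩
    exact hL.left_ne_right j i hj
  by_cases hφ : ∃ τ, Satisfies τ (formula s u w z)
  · obtain ⟨τ, hτ⟩ := hφ
    -- Exactly the vertices that `τ` makes blue; `paint` then supplies green and red.
    set B : Set V := {x | (∃ i, τ (.inl i) = false ∧ x = u i) ∨ (∃ i, τ (.inl i) = true ∧ x = w i) ∨
      (∃ j, τ (.inr j) = true ∧ x = z j) ∨ ∃ j, τ (.inr j) = false ∧ x = z' j} with hB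
    have hBs : ∀ x ∈ B, x ∈ s.rest ∨ x ∈ s.paired := by
      rintro x (⟨i, -, rfl⟩ | ⟨i, -, rfl⟩ | ⟨i, -, rfl⟩ | ⟨i, -, rfl⟩)
      exacts [Or.inl (hL.left_mem i), Or.inl (hL.right_mem i), Or.inr (hL'.left_mem i),
        Or.inr (hL'.right_mem i)]
    have hBu : ∀ i, u i ∈ B ↔ τ (.inl i) = false := by
      intro i
      refine ⟨?_, fun h => Or.inl ⟨i, h, rfl⟩⟩
      rintro (⟨j, h', e⟩ | ⟨j, -, e⟩ | ⟨j, -, e⟩ | ⟨j, -, e⟩)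
      · rwa [hL.left_injective e]
      · exact absurd e (hL.left_ne_right i j)
      · exact absurd (hz j) (e ▸ hu i)
      · exact absurd (hz' j) (e ▸ hu i)
    have hBw : ∀ i, w i ∈ B ↔ τ (.inl i) = true := by
      intro i
      refine ⟨?_, fun h => Or.inr (Or.inl ⟨i, h, rfl⟩)⟩
      rintro (⟨j, -, e⟩ | ⟨j, h', e⟩ | ⟨j, -, e⟩ | ⟨j, -, e⟩)
      · exact absurd e.symm (hL.left_ne_right j i)
      · rwa [hL.right_injective e]
      · exact absurd (hz j) (e ▸ hw i)
      · exact absurd (hz' j) (e ▸ hw i)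
    have hBz : ∀ i, z i ∈ B ↔ τ (.inr i) = true := by
      intro i
      refine ⟨?_, fun h => Or.inr (Or.inr (Or.inl ⟨i, h, rfl⟩))⟩
      rintro (⟨j, -, e⟩ | ⟨j, -, e⟩ | ⟨j, h', e⟩ | ⟨j, -, e⟩)
      · exact absurd (hz i) (e ▸ hu j)
      · exact absurd (hz i) (e ▸ hw j)
      · rwa [hL'.left_injective e]
      · exact absurd e (hL'.left_ne_right i j)
    have hBz' : ∀ i, z' i ∈ B ↔ τ (.inr i) = false := by
      intro i
      refine ⟨?_, fun h => Or.inr (Or.inr (Or.inr ⟨i, h, rfl⟩))⟩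
      rintro (⟨j, -, e⟩ | ⟨j, -, e⟩ | ⟨j, -, e⟩ | ⟨j, h', e⟩)
      · exact absurd (hz' i) (e ▸ hu j)
      · exact absurd (hz' i) (e ▸ hw j)
      · exact absurd e.symm (hL'.left_ne_right j i)
      · rwa [hL'.right_injective e]
    refine ⟨_, .sat (s.paint B) u w z z' hR hC hP hZ τ hτ
      (paint_of_notMem_nbhd (fun h' => ?_) root_notMem_nbhd)
      (fun a ha => paint_of_mem_nbhd (fun h' => ?_) ha.1) (fun i => ?_) (fun j => ?_)⟩
    · rcases hBs _ h' with h' | h'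
      · exact (mem_rest.1 h').2.1 rfl
      · exact root_notMem_nbhd (mem_paired.1 h').1
    · rcases hBs _ h' with h' | h'
      · exact (mem_rest.1 h').2.2 ha.1
      · exact h'.2 ha
    · have hu' := hBu i
      have hw' := hBw i
      cases hi : τ (.inl i)
      · exact ⟨paint_of_mem (hu'.2 hi), paint_of_notMem_nbhd (by simp [hw', hi]) (hw i)⟩
      · exact ⟨paint_of_notMem_nbhd (by simp [hu', hi]) (hu i), paint_of_mem (hw'.2 hi)⟩
    · have h₁ := hBz j
      have h₂ := hBz' j
      cases hj : τ (.inr j)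
      · exact ⟨paint_of_mem_nbhd (by simp [h₁, hj]) (hz j), paint_of_mem (h₂.2 hj)⟩
      · exact ⟨paint_of_mem (h₁.2 hj), paint_of_mem_nbhd (by simp [h₂, hj]) (hz' j)⟩
  · exact ⟨none, .unsat u w z z' hR hC hP hZ hφ⟩

end State.IsFinal

end Correctness

/-! ### Soundness, progress and length of runs -/

section Runs

variable {V : Type*} {G : SimpleGraph V} {v₀ : V}

theorem State.Invariant.isFinal {s : State V} (h : s.Invariant G) (hK : s.graph.CliqueFree 4)
    (hs : ¬ ∃ s', Reduce s s') : s.IsFinal G :=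
  ⟨h, hK, fun a b hab => hs ⟨_, (reduce_iff h.adjMem).2 ⟨a, b, hab, rfl⟩⟩⟩

theorem State.Invariant.not_colorable {s : State V} (h : s.Invariant G)
    (hK : ¬ s.graph.CliqueFree 4) : ¬ G.Colorable 3 := by
  intro h3
  obtain ⟨χ, hχ⟩ := h.good h3
  exact hK ((colorable_three_iff.2 ⟨χ, hχ.proper⟩).cliqueFree (by omega))

/-- What holds for the configurations that are reached. -/
def Config.Sound (G : SimpleGraph V) : Config V → Prop
  | .start => True
  | .loop s => s.Invariant G
  | .halted out => IsCorrect G out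

theorem sound_of_reached (hi : IsIrreducible G) (hG : TwoConnecting G)
    (ha : IsArticulationNbhd G v₀) {c : Config V} (hc : Reached G v₀ c) : c.Sound G := by
  induction hc with
  | refl => trivial
  | tail _ hstep ih =>
    cases hstep with
    | notBipartite C hC =>
      exact not_colorable_of_not_colorable_outside hi hG ha
        fun h => hC (SimpleGraph.colorable_iff_forall_connectedComponent.1 h C)
    | merge c m hm => exact hm.invariant hi hG ha
    | reduce s s' hK h => exact State.Invariant.reduce ih h
    | clique s hK => exact State.Invariant.not_colorable ih hK
    | finish s hK hs out h =>
      have hF := State.Invariant.isFinal ih hK hs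
      cases out with
      | none => exact hF.not_colorable_of_finish h
      | some χ => exact fun a b hab => hF.proper_of_finish h (hF.hom a b hab)

theorem not_stuck [Finite V] (hi : IsIrreducible G) (hG : TwoConnecting G)
    (ha : IsArticulationNbhd G v₀) {c : Config V} (hc : Reached G v₀ c) :
    (∃ out, c = .halted out) ∨ ∃ c', Step G v₀ c c' := by
  have hsound := sound_of_reached hi hG ha hc
  cases c with
  | start =>
    right
    by_cases h : ∀ C : (outside G v₀).ConnectedComponent, C.toSimpleGraph.IsBipartite
    · obtain ⟨c⟩ := nonempty_coloring_bool
        (SimpleGraph.colorable_iff_forall_connectedComponent.2 h)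
      obtain ⟨m, hm⟩ := exists_isMerging c
      exact ⟨_, .merge c m hm⟩
    · push Not at h
      obtain ⟨C, hC⟩ := h
      exact ⟨_, .notBipartite C hC⟩
  | loop s =>
    right
    by_cases hK : s.graph.CliqueFree 4
    · by_cases hs : ∃ s', Reduce s s'
      · obtain ⟨s', hs'⟩ := hs
        exact ⟨_, .reduce s s' hK hs'⟩
      · obtain ⟨out, h⟩ := (State.Invariant.isFinal hsound hK hs).exists_finish
        exact ⟨_, .finish s hK hs out h⟩
    · exact ⟨_, .clique s hK⟩
  | halted out => exact Or.inl ⟨out, rfl⟩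

/-- A bound for the number of the remaining transitions. -/
noncomputable def Config.measure : Config V → ℕ
  | .start => Nat.card V + 2
  | .loop s => s.verts.ncard + 1
  | .halted _ => 0

theorem State.AdjMem.ncard_redirect_lt [Finite V] {s : State V} (hs : s.AdjMem) {a b : V}
    (h : s.Candidate a b) : (s.mapBy (redirect a b)).verts.ncard < s.verts.ncard := by
  rw [State.mapBy, State.image_redirect h.ne (h.right_mem hs)]
  exact Set.ncard_sdiff_singleton_lt_of_mem (h.left_mem hs)

theorem measure_lt [Finite V] (hi : IsIrreducible G) (hG : TwoConnecting G)
    (ha : IsArticulationNbhd G v₀) {c c' : Config V} (hc : Reached G v₀ c)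
    (h : Step G v₀ c c') : c'.measure < c.measure := by
  have hsound := sound_of_reached hi hG ha hc
  cases h with
  | notBipartite C hC => simp [Config.measure]
  | merge c m hm =>
    have := Set.ncard_le_card (mergedState G v₀ m).verts
    simp only [Config.measure]
    omega
  | reduce s s' hK h =>
    have hs : s.AdjMem := State.Basic.adjMem (State.Invariant.toBasic hsound)
    obtain ⟨a, b, hab, rfl⟩ := (reduce_iff hs).1 h
    exact Nat.succ_lt_succ (hs.ncard_redirect_lt hab)
  | clique s hK => simp [Config.measure]
  | finish s hK hs out h => simp [Config.measure]

theorem run_length_le [Finite V] (hi : IsIrreducible G) (hG : TwoConnecting G)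
    (ha : IsArticulationNbhd G v₀) {l : ℕ} {run : ℕ → Config V} (h0 : run 0 = .start)
    (hrun : ∀ i < l, Step G v₀ (run i) (run (i + 1))) : l ≤ Nat.card V + 2 := by
  have key : ∀ i ≤ l, Reached G v₀ (run i) ∧ (run i).measure + i ≤ Nat.card V + 2 := by
    intro i
    induction i with
    | zero =>
      intro _
      rw [h0]
      exact ⟨.refl, le_rfl⟩
    | succ i ih =>
      intro hi'
      obtain ⟨h₁, h₂⟩ := ih (by omega)
      have h₃ := hrun i (by omega)
      have h₄ := measure_lt hi hG ha h₁ h₃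
      exact ⟨h₁.tail h₃, by omega⟩
  have := (key l le_rfl).2
  omega

theorem exists_halted [Finite V] (hi : IsIrreducible G) (hG : TwoConnecting G)
    (ha : IsArticulationNbhd G v₀) {c : Config V} (hc : Reached G v₀ c) :
    ∃ out, Reached G v₀ (.halted out) := by
  induction hn : c.measure using Nat.strong_induction_on generalizing c with
  | _ n ih =>
    rcases not_stuck hi hG ha hc with ⟨out, rfl⟩ | ⟨c', h⟩
    · exact ⟨out, hc⟩
    · exact ih _ (hn ▸ measure_lt hi hG ha hc h) (hc.tail h) rfl

/-- Some run halts, and its output is correct. A negative answer of the machine is thus justified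
without imitating any particular run. -/
theorem reached_none_of_not_colorable [Finite V] (hi : IsIrreducible G) (hG : TwoConnecting G)
    (ha : IsArticulationNbhd G v₀) (h : ¬ G.Colorable 3) : Reached G v₀ (.halted none) := by
  obtain ⟨out, hout⟩ := exists_halted hi hG ha (Relation.ReflTransGen.refl : Reached G v₀ .start)
  cases out with
  | none => exact hout
  | some χ => exact absurd (colorable_three_iff.2 ⟨χ, sound_of_reached hi hG ha hout⟩) h

end Runs

/-! ### An explicit final coloring obtained from one blue vertex -/

section FinalColoring

variable {V : Type*} {G : SimpleGraph V} {s : State V}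

/-- If `p` is blue, then `u` can be blue too: the paired neighbors of `u` are neighbors of `p`. -/
def State.Fits (s : State V) (p u : V) : Prop :=
  u ∈ s.rest ∧ ∀ z, z ∈ s.paired ∧ s.graph.Adj u z → s.graph.Adj p z

/-- If `p` is blue, then every component has a vertex that can be blue. -/
def State.Guess (s : State V) (p : V) : Prop :=
  p ∈ s.rest ∧ ∀ x y, x ∈ s.rest ∧ y ∈ s.rest ∧ s.graph.Adj x y → s.Fits p x ∨ s.Fits p y

/-- Any blue vertex of `rest` serves as `p`: every component has a blue end, and all blue vertices
of `rest` fit `p`. -/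
theorem State.IsFinal.exists_guess (h : s.IsFinal G) {χ : V → Color} (hχ : s.IsGood χ)
    (hR : s.rest.Nonempty) :
    ∃ p, s.Guess p := by
  have hedge : ∀ x ∈ s.rest, ∀ y ∈ s.rest, s.graph.Adj x y → χ x = .blue ∨ χ y = .blue := by
    intro x hx y hy hxy
    have := hχ.proper _ _ hxy
    rcases hχ.rest x hx with e | e <;> rcases hχ.rest y hy with e' | e' <;> simp_all
  obtain ⟨p, hp, hpb⟩ : ∃ p ∈ s.rest, χ p = .blue := by
    obtain ⟨x, hx⟩ := hR
    obtain ⟨y, ⟨hy, hxy⟩, -⟩ := h.isMatched_rest x hx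
    rcases hedge x hx y hy hxy with e | e
    exacts [⟨x, hx, e⟩, ⟨y, hy, e⟩]
  have hfit : ∀ u ∈ s.rest, χ u = .blue → s.Fits p u := by
    rintro u hu hub
    refine ⟨hu, fun z ⟨hz, huz⟩ => ?_⟩
    obtain ⟨hz', z', hz'', hzz'⟩ := State.mem_paired.1 hz
    -- Then `p` is adjacent to `z'`, so neither `z` nor `z'` is red or blue, and the edge between
    -- them would be green at both ends.
    by_contra hpz
    have h₁ := hχ.proper _ _ ((h.adj_iff_not_adj hp hz' hz'' hzz').2 hpz)
    have h₂ := hχ.proper _ _ huz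
    have h₃ := hχ.proper _ _ hzz'
    have h₄ := hχ.proper _ _ hz'
    have h₅ := hχ.proper _ _ hz''
    rw [hχ.root] at h₄ h₅
    cases e : χ z <;> cases e' : χ z' <;> simp_all
  refine ⟨p, hp, fun x y ⟨hx, hy, hxy⟩ => ?_⟩
  exact (hedge x hx y hy hxy).imp (hfit x hx) (hfit y hy)

variable [LinearOrder V]

/-- The blue vertices if `p` is blue. -/
def State.blueOf (s : State V) (p : V) : Set V :=
  {x | (x ∈ s.paired ∧ ¬ s.graph.Adj p x) ∨
    (s.Fits p x ∧ ∃ w, w ∈ s.rest ∧ s.graph.Adj x w ∧ (¬ s.Fits p w ∨ x < w))}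

/-- The blue vertices if all other vertices are in the neighborhood of the root. -/
def State.blueOfNoRest (s : State V) : Set V :=
  {x | x ∈ s.paired ∧ ∃ y, y ∈ s.nbhd ∧ s.graph.Adj x y ∧ x < y}

namespace State

theorem blueOf_subset {p x : V} (hx : x ∈ s.blueOf p) : x ∈ s.paired ∨ x ∈ s.rest :=
  hx.imp (fun h => h.1) fun h => h.1.1

namespace IsFinal

theorem finish_blueOfNoRest (h : s.IsFinal G) (hR : s.rest = ∅) :
    Finish s (some (s.paint s.blueOfNoRest)) := by
  have hroot : s.root ∉ s.blueOfNoRest := fun h' => root_notMem_nbhd (mem_paired.1 h'.1).1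
  refine .noRest _ hR (paint_of_notMem_nbhd hroot root_notMem_nbhd) (fun a ha => ?_)
    fun a ha b hb hab => ?_
  · by_cases ha' : a ∈ s.blueOfNoRest
    · exact Or.inl (paint_of_mem ha')
    · exact Or.inr (paint_of_mem_nbhd ha' ha)
  · have key : ∀ a ∈ s.nbhd, ∀ b ∈ s.nbhd, s.graph.Adj a b → (a ∈ s.blueOfNoRest ↔ a < b) := by
      intro a ha b hb hab
      constructor
      · rintro ⟨-, y, hy, hay, hlt⟩
        rwa [h.nbhd_unique ha hb hy hab hay]
      · exact fun hlt => ⟨mem_paired.2 ⟨ha, b, hb, hab⟩, b, hb, hab, hlt⟩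
    have h₁ := key a ha b hb hab
    have h₂ := key b hb a ha hab.symm
    rcases lt_or_gt_of_ne hab.ne with hlt | hlt
    · rw [paint_of_mem (h₁.2 hlt), paint_of_mem_nbhd (fun h' => (h₂.1 h').asymm hlt) hb]
      simp
    · rw [paint_of_mem (h₂.2 hlt), paint_of_mem_nbhd (fun h' => (h₁.1 h').asymm hlt) ha]
      simp

/-- Exactly one end of each paired edge is a non-neighbor of `p`. A blue vertex of `rest` fits `p`,
so its paired neighbors are neighbors of `p` and hence green. -/
theorem isGood_blueOf (h : s.IsFinal G) {p : V} (hp : s.Guess p) :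
    s.IsGood (s.paint (s.blueOf p)) := by
  have hroot : s.root ∉ s.blueOf p := fun h' => by
    rcases blueOf_subset h' with h' | h'
    · exact root_notMem_nbhd (mem_paired.1 h').1
    · exact (mem_rest.1 h').2.1 rfl
  have hrest : ∀ x ∈ s.rest, s.paint (s.blueOf p) x = .red ∨ s.paint (s.blueOf p) x = .blue := by
    intro x hx
    by_cases hx' : x ∈ s.blueOf p
    · exact Or.inr (paint_of_mem hx')
    · exact Or.inl (paint_of_notMem_nbhd hx' (mem_rest.1 hx).2.2)
  have hN : ∀ x ∈ s.nbhd, (x ∈ s.blueOf p ↔ x ∈ s.paired ∧ ¬ s.graph.Adj p x) := by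
    refine fun x hx => ⟨fun h' => ?_, Or.inl⟩
    rcases h' with h' | h'
    · exact h'
    · exact absurd hx (mem_rest.1 h'.1.1).2.2
  have hB : ∀ x ∈ s.rest, ∀ y ∈ s.rest, s.graph.Adj x y →
      (x ∈ s.blueOf p ↔ s.Fits p x ∧ (¬ s.Fits p y ∨ x < y)) := by
    intro x hx y hy hxy
    constructor
    · rintro (h' | ⟨h₁, w, hw, hxw, h₂⟩)
      · exact absurd (mem_paired.1 h'.1).1 (mem_rest.1 hx).2.2
      · rw [(h.isMatched_rest x hx).unique ⟨hy, hxy⟩ ⟨hw, hxw⟩]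
        exact ⟨h₁, h₂⟩
    · exact fun h' => Or.inr ⟨h'.1, y, hy, hxy, h'.2⟩
  have hroot' := paint_of_notMem_nbhd hroot root_notMem_nbhd
  refine ⟨fun x y hxy => h.adjMem.proper hroot' (fun a ha => ?_) (fun a ha b hb hab => ?_)
      (fun a ha b hb hab => ?_) (fun a ha b hb hab => ?_) hxy, hroot', hrest⟩
  · by_cases ha' : a ∈ s.blueOf p
    · simp [paint_of_mem ha']
    · simp [paint_of_mem_nbhd ha' ha]
  · have hpab := h.adj_iff_not_adj hp.1 ha hb hab
    have ha' := hN a ha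
    have hb' := hN b hb
    have hap : a ∈ s.paired := mem_paired.2 ⟨ha, b, hb, hab⟩
    have hbp : b ∈ s.paired := mem_paired.2 ⟨hb, a, ha, hab.symm⟩
    by_cases hpa : s.graph.Adj p a
    · rw [paint_of_mem (hb'.2 ⟨hbp, fun h' => hpab.1 h' hpa⟩),
        paint_of_mem_nbhd (fun h' => (ha'.1 h').2 hpa) ha]
      simp
    · rw [paint_of_mem (ha'.2 ⟨hap, hpa⟩),
        paint_of_mem_nbhd (fun h' => (hb'.1 h').2 (hpab.2 hpa)) hb]
      simp
  · have ha' := hB a ha b hb hab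
    have hb' := hB b hb a ha hab.symm
    have hor := hp.2 a b ⟨ha, hb, hab⟩
    -- At least one end fits `p`; if both do, the smaller one is blue.
    have hiff : a ∈ s.blueOf p ↔ b ∉ s.blueOf p := by
      rw [ha', hb']
      rcases lt_or_gt_of_ne hab.ne with hlt | hlt
      · have := hlt.asymm
        tauto
      · have := hlt.asymm
        tauto
    by_cases hab' : a ∈ s.blueOf p
    · rw [paint_of_mem hab', paint_of_notMem_nbhd (hiff.1 hab') (mem_rest.1 hb).2.2]
      simp
    · rw [paint_of_mem (not_not.1 fun h' => hab' (hiff.2 h')),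
        paint_of_notMem_nbhd hab' (mem_rest.1 ha).2.2]
      simp
  · by_cases hb' : b ∈ s.blueOf p
    · have ha' : a ∉ s.blueOf p := by
        intro ha'
        have ha'' := (hN a ha).1 ha'
        rcases hb' with hb' | hb'
        · exact (mem_rest.1 hb).2.2 (mem_paired.1 hb'.1).1
        · exact ha''.2 (hb'.1.2 a ⟨ha''.1, hab.symm⟩)
      rw [paint_of_mem hb', paint_of_mem_nbhd ha' ha]
      simp
    · rw [paint_of_notMem_nbhd hb' (mem_rest.1 hb).2.2]
      by_cases ha' : a ∈ s.blueOf p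
      · simp [paint_of_mem ha']
      · simp [paint_of_mem_nbhd ha' ha]

theorem finish_blueOf [Finite V] (h : s.IsFinal G) {p : V} (hp : s.Guess p) :
    Finish s (some (s.paint (s.blueOf p))) := by
  refine h.finish_of_isGood (h.isGood_blueOf hp) (Set.nonempty_iff_ne_empty.1 ⟨p, hp.1⟩)
    fun a ha => paint_of_mem_nbhd (fun h' => ?_) ha.1
  rcases blueOf_subset h' with h' | h'
  · exact h'.2 ha
  · exact (mem_rest.1 h').2.2 ha.1

end IsFinal

end State

end FinalColoring

/-! ### Color classes of the components via walks of even length -/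

section EvenWalks

variable {V : Type*} {G : SimpleGraph V} {v₀ : V}

/-- Adjacency in `G - N[v₀]`. -/
def OutAdj (G : SimpleGraph V) (v₀ x y : V) : Prop :=
  G.Adj x y ∧ (x ≠ v₀ ∧ ¬ G.Adj v₀ x) ∧ y ≠ v₀ ∧ ¬ G.Adj v₀ y

/-- Connection by a walk of even length in `G - N[v₀]`. -/
def Even (G : SimpleGraph V) (v₀ : V) : V → V → Prop :=
  Relation.ReflTransGen fun x y => ∃ z, OutAdj G v₀ x z ∧ OutAdj G v₀ z y

theorem OutAdj.symm {x y : V} (h : OutAdj G v₀ x y) : OutAdj G v₀ y x := ⟨h.1.symm, h.2.2, h.2.1⟩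

theorem outAdj_coe {x y : ↥(closedNbhd G v₀)ᶜ} :
    OutAdj G v₀ x y ↔ (outside G v₀).Adj x y :=
  ⟨fun h => h.1, fun h => ⟨h, notMem_closedNbhd.1 x.2, notMem_closedNbhd.1 y.2⟩⟩

theorem Even.symm {x y : V} (h : Even G v₀ x y) : Even G v₀ y x := by
  induction h with
  | refl => exact .refl
  | tail _ h ih =>
    obtain ⟨z, h₁, h₂⟩ := h
    exact .head ⟨z, h₂.symm, h₁.symm⟩ ih

theorem Even.eq_of_mem {x y : V} (h : Even G v₀ x y) (hx : x ∈ closedNbhd G v₀) : y = x := by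
  rcases Relation.ReflTransGen.cases_head h with h | ⟨z, ⟨w, hw, -⟩, -⟩
  · exact h.symm
  · exact absurd hx (notMem_closedNbhd.2 hw.2.1)

theorem Even.reachable {x : ↥(closedNbhd G v₀)ᶜ} {y : V} (h : Even G v₀ x y) :
    ∃ y' : ↥(closedNbhd G v₀)ᶜ, y = y' ∧ (outside G v₀).Reachable x y' ∧
      ∀ c : (outside G v₀).Coloring Bool, c x = c y' := by
  induction h with
  | refl => exact ⟨x, rfl, .refl x, fun _ => rfl⟩
  | tail _ hstep ih =>
    obtain ⟨a, rfl, ha, hc⟩ := ih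
    obtain ⟨z, h₁, h₂⟩ := hstep
    let z' : ↥(closedNbhd G v₀)ᶜ := ⟨z, notMem_closedNbhd.2 h₁.2.2⟩
    have e₁ : (outside G v₀).Adj a z' := h₁.1
    refine ⟨⟨_, notMem_closedNbhd.2 h₂.2.2⟩, rfl, ?_, fun c => ?_⟩
    · have e₂ : (outside G v₀).Adj z' ⟨_, notMem_closedNbhd.2 h₂.2.2⟩ := h₂.1
      exact ha.trans (e₁.reachable.trans e₂.reachable)
    · have e₂ : (outside G v₀).Adj z' ⟨_, notMem_closedNbhd.2 h₂.2.2⟩ := h₂.1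
      have h₁ := c.valid e₁
      have h₂ := c.valid e₂
      rw [hc c]
      revert h₁ h₂
      generalize c a = p
      generalize c z' = q
      generalize c _ = r
      revert p q r
      decide

theorem even_or_of_reachable {x y : ↥(closedNbhd G v₀)ᶜ} (h : (outside G v₀).Reachable x y) :
    Even G v₀ x y ∨ ∃ z, Even G v₀ x z ∧ OutAdj G v₀ z y := by
  rw [SimpleGraph.reachable_iff_reflTransGen] at h
  induction h with
  | refl => exact Or.inl .refl
  | tail _ hstep ih =>
    rcases ih with ih | ⟨z, hz, hzy⟩
    · exact Or.inr ⟨_, ih, outAdj_coe.2 hstep⟩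
    · exact Or.inl (hz.tail ⟨_, hzy, outAdj_coe.2 hstep⟩)

theorem even_iff (c : (outside G v₀).Coloring Bool) {x y : ↥(closedNbhd G v₀)ᶜ} :
    Even G v₀ x y ↔ (outside G v₀).Reachable x y ∧ c x = c y := by
  constructor
  · intro h
    obtain ⟨y', hy, h₁, h₂⟩ := h.reachable
    rw [Subtype.ext hy]
    exact ⟨h₁, h₂ c⟩
  · rintro ⟨h, hc⟩
    rcases even_or_of_reachable h with h | ⟨z, hz, hzy⟩
    · exact h
    · obtain ⟨z', rfl, -, h'⟩ := hz.reachable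
      exact absurd ((h' c).symm.trans hc) (c.valid (outAdj_coe.1 hzy))

/-- Bipartiteness as the absence of odd closed walks. The relation `Even` describes the color
classes without reference to a coloring, so it can be computed by iteration. -/
theorem colorable_outside_iff :
    (outside G v₀).Colorable 2 ↔ ¬ ∃ x y, Even G v₀ x y ∧ OutAdj G v₀ x y := by
  classical
  constructor
  · rintro hc ⟨x, y, h, hxy⟩
    obtain ⟨c⟩ := nonempty_coloring_bool hc
    have hx : x ∉ closedNbhd G v₀ := notMem_closedNbhd.2 hxy.2.1
    have hy : y ∉ closedNbhd G v₀ := notMem_closedNbhd.2 hxy.2.2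
    exact c.valid (outAdj_coe (x := ⟨x, hx⟩) (y := ⟨y, hy⟩) |>.1 hxy)
      ((even_iff c (x := ⟨x, hx⟩) (y := ⟨y, hy⟩)).1 h).2
  · intro h
    let r : ↥(closedNbhd G v₀)ᶜ → ↥(closedNbhd G v₀)ᶜ :=
      fun x => ((outside G v₀).connectedComponentMk x).exists_rep.choose
    have hr : ∀ x, (outside G v₀).Reachable (r x) x := fun x =>
      SimpleGraph.ConnectedComponent.exact
        ((outside G v₀).connectedComponentMk x).exists_rep.choose_spec
    refine ⟨SimpleGraph.Coloring.mk
      (fun x => if Even G v₀ (r x) x then (0 : Fin 2) else 1) fun {x y} hxy => ?_⟩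
    have hrxy : r x = r y := by
      simp only [r, SimpleGraph.ConnectedComponent.sound hxy.reachable]
    have hxy' := outAdj_coe.2 hxy
    rw [← hrxy]
    -- Two adjacent even vertices would close an odd walk through the representative. If `x` is not
    -- even, an odd walk reaches it, and one more edge makes `y` even.
    by_cases h₁ : Even G v₀ (r x) x
    · have h₂ : ¬ Even G v₀ (r x) y := fun h₂ => h ⟨x, y, h₁.symm.trans h₂, hxy'⟩
      simp [h₁, h₂]
    · rcases even_or_of_reachable (hr x) with h' | ⟨z, hz, hzx⟩
      · exact absurd h' h₁
      · have h₂ : Even G v₀ (r x) y := hz.tail ⟨x, hzx, hxy'⟩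
        simp [h₁, h₂]

/-- The map to the least vertex that is connected by a walk of even length merges the color
classes. -/
theorem isMerging_of_least [LinearOrder V] (c : (outside G v₀).Coloring Bool) {m : V → V}
    (hm : ∀ x y, m x = y ↔ Even G v₀ x y ∧ ∀ z, Even G v₀ x z → ¬ z < y) :
    IsMerging G v₀ c m := by
  have hE : ∀ x, Even G v₀ x (m x) := fun x => ((hm x _).1 rfl).1
  refine ⟨fun x hx => (hE x).eq_of_mem hx, fun x => ?_, fun x y h h' => ?_⟩
  · obtain ⟨y, h₁, h₂, h₃⟩ := (hE x).reachable
    exact ⟨y, h₁, h₂, h₃ c⟩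
  · have hxy := (even_iff c).2 ⟨h, h'⟩
    rw [hm]
    exact ⟨hxy.trans (hE y), fun z hz => ((hm y _).1 rfl).2 z (hxy.symm.trans hz)⟩

end EvenWalks

/-! ### The algorithm as a command, and its agreement with the transition system -/

section Algorithm

namespace Cmd

/-- Replace the relation `0` (the edges) and the descriptions of the vertex set, of the root (`2`
and `3`, on the diagonal) and of the representatives (`4`) by their images under the map whose graph
is the relation `7`. -/
def applyMap : Cmd :=
  .seq (.upd 0 (.ex (.ex (.and (.rel 0 3 4) (.and (.rel 7 3 1) (.rel 7 4 2)))))) <|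
  .seq (.upd 2 (.ex (.and (.rel 2 3 3) (.rel 7 3 1)))) <|
  .seq (.upd 3 (.ex (.and (.rel 3 3 3) (.rel 7 3 1)))) <|
  .upd 4 (.ex (.and (.rel 4 1 3) (.rel 7 3 2)))

/-- `OutAdj` for two variables. -/
def outAdj (x y : ℕ) : Fml :=
  .and (.rel 0 x y) (.and (.and (.not (.eq x 0)) (.not (.rel 0 0 x)))
    (.and (.not (.eq y 0)) (.not (.rel 0 0 y))))

/-- One step in the computation of the relation `Even` (as `5`). -/
def extend : Cmd :=
  .upd 5 (.or (.rel 5 1 2) (.ex (.and (.rel 5 1 3) (.ex (.and (outAdj 3 4) (outAdj 4 2))))))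

/-- Test whether `G - N[v₀]` is bipartite (`6`) and merge the color classes. -/
def mergeClasses : Cmd :=
  .seq (.upd 5 (.eq 1 2)) <|
  .seq (.iter (.iter extend)) <|
  .seq (.upd 6 (.ex (.ex (.and (.rel 5 3 4) (outAdj 3 4))))) <|
  .seq (.upd 7 (.and (.rel 5 1 2) (.all (.imp (.rel 5 1 3) (.not (.lt 3 2)))))) <|
  .seq (.upd 2 (.eq 1 1)) <|
  .seq (.upd 3 (.eq 0 1)) <|
  .seq (.upd 4 (.eq 1 2)) applyMap

/-- Apply the first reduction that is possible: the relation `8` consists of the candidates, and the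
relation `9` of the first candidate. -/
def reduceFirst : Cmd :=
  .seq (.upd 8 (.or
    (.ex (.ex (.and (.not (.eq 1 2)) (.and (.not (.rel 0 1 2)) (.and (.rel 0 1 3) (.and (.rel 0 1 4)
      (.and (.rel 0 2 3) (.and (.rel 0 2 4) (.rel 0 3 4)))))))))
    (.and (.rel 2 1 1) (.and (.rel 2 2 2) (.and (.not (.eq 1 2))
      (.all (.imp (.rel 0 1 3) (.rel 0 2 3)))))))) <|
  .seq (.upd 9 (.and (.rel 8 1 2)
    (.all (.all (.imp (.rel 8 3 4) (.or (.lt 1 3) (.and (.eq 1 3) (.not (.lt 4 2))))))))) <|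
  .seq (.upd 7 (.or (.rel 9 1 2) (.and (.eq 1 2) (.not (.ex (.rel 9 1 3)))))) applyMap

/-- Color the final graph: `16` is the set of the blue vertices, `17` tells whether there is no
3-coloring, and `18` and `19` are the sets of the blue and green vertices of the input graph. The
neighborhood of the root is `10`, the vertices outside the closed neighborhood are `11`, the paired
vertices `12`; `13`, `14` and `15` are `State.Fits`, `State.Guess` and the least guess. -/
def colorFinal : Cmd :=
  .seq (.upd 10 (.ex (.and (.rel 3 3 3) (.rel 0 3 1)))) <|
  .seq (.upd 11 (.and (.rel 2 1 1) (.and (.not (.rel 3 1 1)) (.not (.rel 10 1 1))))) <|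
  .seq (.upd 12 (.and (.rel 10 1 1) (.ex (.and (.rel 10 3 3) (.rel 0 1 3))))) <|
  .seq (.upd 13 (.and (.rel 11 2 2)
    (.all (.imp (.and (.rel 12 3 3) (.rel 0 2 3)) (.rel 0 1 3))))) <|
  .seq (.upd 14 (.and (.rel 11 1 1) (.all (.all (.imp
    (.and (.rel 11 3 3) (.and (.rel 11 4 4) (.rel 0 3 4))) (.or (.rel 13 1 3) (.rel 13 1 4))))))) <|
  .seq (.upd 15 (.and (.rel 14 1 1) (.all (.imp (.rel 14 3 3) (.not (.lt 3 1)))))) <|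
  .seq (.upd 16 (.or
    (.ex (.and (.rel 15 3 3) (.or (.and (.rel 12 1 1) (.not (.rel 0 3 1)))
      (.and (.rel 13 3 1) (.ex (.and (.rel 11 4 4) (.and (.rel 0 1 4)
        (.or (.not (.rel 13 3 4)) (.lt 1 4)))))))))
    (.and (.not (.ex (.rel 11 3 3)))
      (.and (.rel 12 1 1) (.ex (.and (.rel 10 3 3) (.and (.rel 0 1 3) (.lt 1 3)))))))) <|
  .seq (.upd 17 (.or (.rel 6 1 1) (.or
    (.ex (.ex (.ex (.ex (.and (.rel 0 3 4) (.and (.rel 0 3 5) (.and (.rel 0 3 6)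
      (.and (.rel 0 4 5) (.and (.rel 0 4 6) (.rel 0 5 6))))))))))
    (.and (.ex (.rel 11 3 3)) (.not (.ex (.rel 14 3 3))))))) <|
  .seq (.upd 18 (.ex (.and (.rel 4 1 3) (.rel 16 3 3)))) <|
  .upd 19 (.ex (.and (.rel 4 1 3) (.and (.rel 10 3 3) (.not (.rel 16 3 3)))))

/-- The whole algorithm. -/
def algorithm : Cmd := .seq mergeClasses (.seq (.iter reduceFirst) colorFinal)

theorem scoped_algorithm : algorithm.Scoped 0 = true := by decide

end Cmd

variable {n : ℕ} {v₀ : Fin n} {S : Rels n}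

theorem Cmd.run_seq (c d : Cmd) : (Cmd.seq c d).run v₀ S = d.run v₀ (c.run v₀ S) := rfl

theorem Cmd.run_upd (a : ℕ) (φ : Fml) (R : Fin n → Fin n → Prop)
    (h : ∀ x y, φ.Holds S 3 (Cmd.env v₀ x y) ↔ R x y) :
    (Cmd.upd a φ).run v₀ S = Function.update S a R := by
  rw [Cmd.run]
  congr 1
  funext x y
  exact propext (h x y)

/-- The relations describe the state. -/
structure Represents (S : Rels n) (s : State (Fin n)) : Prop where
  adj : ∀ x y, S 0 x y ↔ s.graph.Adj x y
  verts : ∀ x, S 2 x x ↔ x ∈ s.verts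
  root : ∀ x, S 3 x x ↔ s.root = x
  rep : ∀ x y, S 4 x y ↔ s.rep x = y

theorem Represents.applyMap {s : State (Fin n)} (h : Represents S s) {f : Fin n → Fin n}
    (hf : Separates s.graph f) (hS : ∀ x y, S 7 x y ↔ f x = y) :
    Represents (Cmd.applyMap.run v₀ S) (s.mapBy f) := by
  have h0 := h.adj
  have h2 := h.verts
  have h3 := h.root
  have h4 := h.rep
  constructor
  · intro x y
    rw [State.mapBy_adj hf]
    simp [Cmd.applyMap, Cmd.run, Fml.Holds, Cmd.env, h0, hS]
  · intro x
    simp [Cmd.applyMap, Cmd.run, Fml.Holds, Cmd.env, h2, hS, State.mapBy]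
  · intro x
    simp [Cmd.applyMap, Cmd.run, Fml.Holds, Cmd.env, h3, hS, State.mapBy]
  · intro x y
    simp [Cmd.applyMap, Cmd.run, Fml.Holds, Cmd.env, h4, hS, State.mapBy]

theorem applyMap_six : Cmd.applyMap.run v₀ S 6 = S 6 := by
  simp [Cmd.applyMap, Cmd.run]

theorem reduceFirst_six : Cmd.reduceFirst.run v₀ S 6 = S 6 := by
  simp [Cmd.reduceFirst, Cmd.run, applyMap_six]

theorem State.mapBy_id (s : State (Fin n)) : s.mapBy id = s := by
  simp [State.mapBy]

/-- The lexicographically least candidate is a definable choice. Without candidates the relation `7`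
is the identity, so superfluous rounds are harmless. -/
theorem Represents.reduceFirst {s : State (Fin n)} (h : Represents S s) :
    ((∀ a b, ¬ s.Candidate a b) ∧ Represents (Cmd.reduceFirst.run v₀ S) s) ∨
      ∃ a b, s.Candidate a b ∧ Represents (Cmd.reduceFirst.run v₀ S) (s.mapBy (redirect a b)) := by
  classical
  have h0 := h.adj
  have h2 := h.verts
  simp only [Cmd.reduceFirst, Cmd.run_seq]
  rw [Cmd.run_upd 8 _ s.Candidate (by
    intro x y
    simp [Fml.Holds, Fml.holds_or, Fml.holds_imp, Fml.holds_all, Cmd.env,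
      h0, h2, State.Candidate, IsDiamond, IsSibling, Set.subset_def])]
  rw [Cmd.run_upd 9 _ (fun x y => s.Candidate x y ∧
      ∀ a b, s.Candidate a b → toLex (x, y) ≤ toLex (a, b)) (by
    intro x y
    simp [Fml.Holds, Fml.holds_or, Fml.holds_imp, Fml.holds_all, Cmd.env,
      Prod.Lex.le_iff])]
  by_cases hc : ∃ p : Fin n ×ₗ Fin n, s.Candidate (ofLex p).1 (ofLex p).2
  · right
    obtain ⟨p, hp, hmin⟩ := Set.exists_min_image
      {p : Fin n ×ₗ Fin n | s.Candidate (ofLex p).1 (ofLex p).2} id (Set.toFinite _) hc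
    refine ⟨(ofLex p).1, (ofLex p).2, hp, ?_⟩
    have hsel : ∀ x y, (s.Candidate x y ∧
        ∀ a b, s.Candidate a b → toLex (x, y) ≤ toLex (a, b)) ↔
          x = (ofLex p).1 ∧ y = (ofLex p).2 := by
      intro x y
      constructor
      · rintro ⟨h₁, h₂⟩
        have := le_antisymm (h₂ _ _ hp) (hmin (toLex (x, y)) h₁)
        rw [← ofLex_inj] at this
        exact Prod.ext_iff.1 this
      · rintro ⟨rfl, rfl⟩
        exact ⟨hp, fun a b hab => hmin (toLex (a, b)) hab⟩
    rw [Cmd.run_upd 7 _ (fun x y => redirect (ofLex p).1 (ofLex p).2 x = y) (by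
      intro x y
      simp only [Fml.Holds, Fml.holds_or, Cmd.env, Function.update_apply]
      simp only [hsel]
      by_cases hx : x = (ofLex p).1
      · simp [hx, redirect_self, eq_comm]
      · simp [hx, redirect_of_ne hx])]
    refine Represents.applyMap ⟨?_, ?_, ?_, ?_⟩ (State.Candidate.separates hp) (fun x y => ?_)
    · simpa using h.adj
    · simpa using h.verts
    · simpa using h.root
    · simpa using h.rep
    · simp
  · left
    have hc' : ∀ a b, ¬ s.Candidate a b := fun a b hab => hc ⟨toLex (a, b), hab⟩
    refine ⟨hc', ?_⟩
    rw [Cmd.run_upd 7 _ (fun x y => id x = y) (by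
      intro x y
      simp [Fml.Holds, Fml.holds_or, Cmd.env, hc'])]
    refine Eq.subst (motive := Represents _) s.mapBy_id (Represents.applyMap (f := id)
      ⟨?_, ?_, ?_, ?_⟩ (fun x y hxy => hxy.ne) fun x y => by simp)
    · simpa using h.adj
    · simpa using h.verts
    · simpa using h.root
    · simpa using h.rep

theorem Represents.colorFinal {s : State (Fin n)} (h : Represents S s) {T : Rels n}
    (hT : T = Cmd.colorFinal.run v₀ S) {B : Set (Fin n)}
    (hB : ∀ x, x ∈ B ↔ (∃ p, (s.Guess p ∧ ∀ p', s.Guess p' → p ≤ p') ∧ x ∈ s.blueOf p) ∨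
      (¬ ∃ x, x ∈ s.rest) ∧ x ∈ s.blueOfNoRest) :
    (T 17 v₀ v₀ ↔ S 6 v₀ v₀ ∨ ¬ s.graph.CliqueFree 4 ∨
      ((∃ x, x ∈ s.rest) ∧ ¬ ∃ p, s.Guess p)) ∧
    (∀ x, T 18 x x ↔ s.rep x ∈ B) ∧ ∀ x, T 19 x x ↔ s.rep x ∈ s.nbhd ∧ s.rep x ∉ B := by
  have h0 := h.adj
  have h2 := h.verts
  have h3 := h.root
  have h4 := h.rep
  simp only [Cmd.colorFinal, Cmd.run_seq] at hT
  rw [Cmd.run_upd 10 _ (fun x _ => x ∈ s.nbhd) (by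
    intro x y
    simp [Fml.Holds, Cmd.env, h0, h3, State.nbhd])] at hT
  rw [Cmd.run_upd 11 _ (fun x _ => x ∈ s.rest) (by
    intro x y
    simp [Fml.Holds, Cmd.env, h2, h3, State.mem_rest, eq_comm])] at hT
  rw [Cmd.run_upd 12 _ (fun x _ => x ∈ s.paired) (by
    intro x y
    simp [Fml.Holds, Cmd.env, h0, State.mem_paired])] at hT
  rw [Cmd.run_upd 13 _ (fun x y => s.Fits x y) (by
    intro x y
    simp [Fml.Holds, Fml.holds_imp, Fml.holds_all, Cmd.env, h0, State.Fits])] at hT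
  rw [Cmd.run_upd 14 _ (fun x _ => s.Guess x) (by
    intro x y
    simp [Fml.Holds, Fml.holds_imp, Fml.holds_or, Fml.holds_all, Cmd.env, h0, State.Guess])] at hT
  rw [Cmd.run_upd 15 _ (fun x _ => s.Guess x ∧ ∀ p, s.Guess p → x ≤ p) (by
    intro x y
    simp [Fml.Holds, Fml.holds_imp, Fml.holds_all, Cmd.env])] at hT
  rw [Cmd.run_upd 16 _ (fun x _ => x ∈ B) (by
    intro x y
    simp [Fml.Holds, Fml.holds_or, Cmd.env, h0, hB, State.blueOf, State.blueOfNoRest])] at hT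
  rw [Cmd.run_upd 17 _ (fun x _ => S 6 x x ∨ ¬ s.graph.CliqueFree 4 ∨
      ((∃ x, x ∈ s.rest) ∧ ¬ ∃ p, s.Guess p)) (by
    intro x y
    simp [Fml.Holds, Fml.holds_or, Cmd.env, h0, not_cliqueFree_four])] at hT
  rw [Cmd.run_upd 18 _ (fun x _ => s.rep x ∈ B) (by
    intro x y
    simp [Fml.Holds, Cmd.env, h4])] at hT
  rw [Cmd.run_upd 19 _ (fun x _ => s.rep x ∈ s.nbhd ∧ s.rep x ∉ B) (by
    intro x y
    simp [Fml.Holds, Cmd.env, h4])] at hT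
  subst hT
  simp

/-- The relation grows at each step until it is closed. -/
theorem iterate_extend {G : SimpleGraph (Fin n)} (h0 : ∀ x y, S 0 x y ↔ G.Adj x y)
    (h5 : ∀ x y, S 5 x y ↔ x = y) (i : ℕ) :
    ∃ R : Fin n → Fin n → Prop, (Cmd.extend.run v₀)^[i] S = Function.update S 5 R ∧
      (∀ x, R x x) ∧ (∀ x y, R x y → Even G v₀ x y) ∧
      ((∀ x y, R x y ↔ Even G v₀ x y) ∨ i < {p : Fin n × Fin n | R p.1 p.2}.ncard) := by
  induction i with
  | zero =>
    refine ⟨S 5, by simp, fun x => (h5 x x).2 rfl, fun x y h => (h5 x y).1 h ▸ .refl, Or.inr ?_⟩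
    exact (Set.ncard_pos (Set.toFinite _)).2 ⟨(v₀, v₀), (h5 v₀ v₀).2 rfl⟩
  | succ i ih =>
    obtain ⟨R, hR, hrefl, hsub, hgrow⟩ := ih
    set R' : Fin n → Fin n → Prop := fun x y =>
      R x y ∨ ∃ w, R x w ∧ ∃ z, OutAdj G v₀ w z ∧ OutAdj G v₀ z y with hR'
    have hrun : Cmd.extend.run v₀ (Function.update S 5 R) =
        Function.update (Function.update S 5 R) 5 R' := Cmd.run_upd 5 _ R' (by
      intro x y
      simp [Fml.Holds, Fml.holds_or, Cmd.env, Cmd.outAdj, h0, hR', OutAdj])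
    rw [Function.update_idem] at hrun
    have hsub' : ∀ x y, R' x y → Even G v₀ x y := by
      rintro x y (h | ⟨w, hw, hstep⟩)
      · exact hsub x y h
      · exact (hsub x w hw).tail hstep
    refine ⟨R', by rw [Function.iterate_succ_apply', hR, hrun], fun x => Or.inl (hrefl x),
      hsub', ?_⟩
    by_cases hcl : ∀ x y, R' x y → R x y
    · left
      refine fun x y => ⟨hsub' x y, fun h => ?_⟩
      induction h with
      | refl => exact Or.inl (hrefl x)
      | tail _ hstep ih => exact Or.inr ⟨_, hcl _ _ ih, hstep⟩
    · push Not at hcl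
      obtain ⟨x, y, hxy, hxy'⟩ := hcl
      rcases hgrow with hgrow | hgrow
      · exact absurd ((hgrow x y).2 (hsub' x y hxy)) hxy'
      · right
        refine lt_of_le_of_lt hgrow (Set.ncard_lt_ncard ?_ (Set.toFinite _))
        exact ⟨fun p hp => Or.inl hp, fun h => hxy' (h (a := (x, y)) hxy)⟩

/-- Two nested iterations give `n * n` rounds. After that many rounds an unclosed relation would
have more than `n * n` pairs. -/
theorem run_iter_iter_extend {G : SimpleGraph (Fin n)} (h0 : ∀ x y, S 0 x y ↔ G.Adj x y)
    (h5 : ∀ x y, S 5 x y ↔ x = y) :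
    (Cmd.iter (.iter .extend)).run v₀ S = Function.update S 5 (Even G v₀) := by
  have hrun : (Cmd.iter (.iter .extend)).run v₀ S = (Cmd.extend.run v₀)^[n * n] S := by
    rw [Function.iterate_mul]; rfl
  obtain ⟨R, hR, -, -, h⟩ := iterate_extend (v₀ := v₀) h0 h5 (n * n)
  rw [hrun, hR]
  rcases h with h | h
  · congr 1
    funext x y
    exact propext (h x y)
  · have := Set.ncard_le_card {p : Fin n × Fin n | R p.1 p.2}
    rw [Nat.card_prod, Nat.card_fin] at this
    omega

theorem mergeClasses_spec (G : SimpleGraph (Fin n)) {T : Rels n}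
    (hT : T = Cmd.mergeClasses.run v₀ (inputRels G)) :
    (∀ x y, T 6 x y ↔ ¬ (outside G v₀).Colorable 2) ∧
    ((outside G v₀).Colorable 2 → ∃ c m, IsMerging G v₀ c m ∧
      Represents T (mergedState G v₀ m)) := by
  classical
  have h0 : ∀ x y, inputRels G 0 x y ↔ G.Adj x y := fun x y => by simp [inputRels]
  have hleast : ∀ x, ∃ y, Even G v₀ x y ∧ ∀ z, Even G v₀ x z → ¬ z < y := fun x => by
    obtain ⟨y, hy, hmin⟩ := Set.exists_min_image {y | Even G v₀ x y} id (Set.toFinite _) ⟨x, .refl⟩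
    exact ⟨y, hy, fun z hz => not_lt.2 (hmin z hz)⟩
  choose m hm using hleast
  have hm' : ∀ x y, m x = y ↔ Even G v₀ x y ∧ ∀ z, Even G v₀ x z → ¬ z < y := by
    refine fun x y => ⟨fun h => h ▸ hm x, fun h => ?_⟩
    exact le_antisymm (not_lt.1 ((hm x).2 y h.1)) (not_lt.1 (h.2 _ (hm x).1))
  simp only [Cmd.mergeClasses] at hT
  rw [Cmd.run_seq, Cmd.run_upd 5 _ (fun x y => x = y) (by simp [Fml.Holds, Cmd.env]),
    Cmd.run_seq, run_iter_iter_extend (G := G) (by simpa using h0) (by simp),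
    Function.update_idem] at hT
  simp only [Cmd.run_seq] at hT
  rw [Cmd.run_upd 6 _ (fun _ _ => ¬ (outside G v₀).Colorable 2) (by
    intro x y
    simp [Fml.Holds, Cmd.env, Cmd.outAdj, h0, colorable_outside_iff, OutAdj, and_assoc])] at hT
  rw [Cmd.run_upd 7 _ (fun x y => m x = y) (by
    intro x y
    simp [Fml.Holds, Fml.holds_imp, Fml.holds_all, Cmd.env, hm'])] at hT
  rw [Cmd.run_upd 2 _ (fun _ _ => True) (by simp [Fml.Holds])] at hT
  rw [Cmd.run_upd 3 _ (fun x _ => v₀ = x) (by simp [Fml.Holds, Cmd.env])] at hT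
  rw [Cmd.run_upd 4 _ (fun x y => x = y) (by simp [Fml.Holds, Cmd.env])] at hT
  subst hT
  refine ⟨fun x y => by rw [applyMap_six]; simp, ?_⟩
  intro hc
  obtain ⟨c⟩ := nonempty_coloring_bool hc
  have hmerge := isMerging_of_least c hm'
  refine ⟨c, m, hmerge, ?_⟩
  rw [mergedState_eq hmerge.root]
  refine Represents.applyMap ⟨?_, ?_, ?_, ?_⟩ hmerge.separates ?_
  · simpa [initialState] using h0
  · simp [initialState]
  · simp [initialState]
  · simp [initialState]
  · simp

theorem iterate_reduceFirst {G : SimpleGraph (Fin n)} {s₀ : State (Fin n)} (h : Represents S s₀)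
    (h₀ : s₀.Invariant G) (i : ℕ) :
    ∃ s, Represents ((Cmd.reduceFirst.run v₀)^[i] S) s ∧
      Relation.ReflTransGen Reduce s₀ s ∧ s.Invariant G ∧
      ((∀ a b, ¬ s.Candidate a b) ∨ s.verts.ncard + i ≤ n) := by
  induction i with
  | zero =>
    refine ⟨s₀, h, .refl, h₀, Or.inr ?_⟩
    simpa using Set.ncard_le_card s₀.verts
  | succ i ih =>
    obtain ⟨s, hs, hred, hinv, hcard⟩ := ih
    rw [Function.iterate_succ_apply']
    rcases hs.reduceFirst (v₀ := v₀) with ⟨hno, hs'⟩ | ⟨a, b, hab, hs'⟩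
    · exact ⟨s, hs', hred, hinv, Or.inl hno⟩
    · refine ⟨_, hs', hred.tail ((reduce_iff hinv.adjMem).2 ⟨a, b, hab, rfl⟩),
        hinv.redirect hab, Or.inr ?_⟩
      rcases hcard with hcard | hcard
      · exact absurd hab (hcard a b)
      · have := hinv.adjMem.ncard_redirect_lt hab
        omega

/-- Each reduction loses a vertex while the root always remains, so `n` rounds exhaust all
reductions. -/
theorem run_iter_reduceFirst {G : SimpleGraph (Fin n)} {s₀ : State (Fin n)} (h : Represents S s₀)
    (h₀ : s₀.Invariant G) :
    ∃ s, Represents ((Cmd.iter .reduceFirst).run v₀ S) s ∧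
      Relation.ReflTransGen Reduce s₀ s ∧ s.Invariant G ∧ ∀ a b, ¬ s.Candidate a b := by
  obtain ⟨s, h₁, h₃, h₄, h₅⟩ := iterate_reduceFirst (v₀ := v₀) h h₀ n
  refine ⟨s, h₁, h₃, h₄, ?_⟩
  rcases h₅ with h₅ | h₅
  · exact h₅
  · have := (Set.ncard_pos (Set.toFinite _)).2 ⟨_, h₄.root_mem⟩
    omega

/-- A `K₄` survives separating maps. The machine may therefore keep reducing and look for a `K₄`
only at the end: if none is left, there was none before, and its reductions form a legitimate run.
-/
theorem cliqueFree_of_mapBy {V : Type*} {s : State V} {f : V → V} (hf : Separates s.graph f)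
    (h : (s.mapBy f).graph.CliqueFree 4) : s.graph.CliqueFree 4 := by
  by_contra hK
  obtain ⟨a, b, c, d, h₁, h₂, h₃, h₄, h₅, h₆⟩ := not_cliqueFree_four.1 hK
  exact not_cliqueFree_four.2 ⟨f a, f b, f c, f d, State.adj_mapBy hf h₁, State.adj_mapBy hf h₂,
    State.adj_mapBy hf h₃, State.adj_mapBy hf h₄, State.adj_mapBy hf h₅, State.adj_mapBy hf h₆⟩ h

theorem reached_of_reduce {V : Type*} {G : SimpleGraph V} {v₀ : V} {s₀ s : State V}
    (h₀ : s₀.Invariant G) (hr : Reached G v₀ (.loop s₀)) (h : Relation.ReflTransGen Reduce s₀ s)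
    (hK : s.graph.CliqueFree 4) : Reached G v₀ (.loop s) := by
  induction h with
  | refl => exact hr
  | @tail s₁ s₂ h hstep ih =>
    have hinv : s₁.Invariant G := by
      clear ih hstep hK
      induction h with
      | refl => exact h₀
      | tail _ hstep ih => exact ih.reduce hstep
    obtain ⟨a, b, hab, rfl⟩ := (reduce_iff hinv.adjMem).1 hstep
    have hK' := cliqueFree_of_mapBy hab.separates hK
    exact (ih hK').tail (.reduce _ _ hK' hstep)

theorem six_run_iter_reduceFirst : (Cmd.iter .reduceFirst).run v₀ S 6 = S 6 := by
  have key : ∀ i, (Cmd.reduceFirst.run v₀)^[i] S 6 = S 6 := by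
    intro i
    induction i with
    | zero => rfl
    | succ i ih => rw [Function.iterate_succ_apply', reduceFirst_six, ih]
  exact key n

/-- If some component is not bipartite, the other relations carry no meaning, but the flag `6` alone
forces the negative answer. -/
theorem run_colorFinal_of_six (h : S 6 v₀ v₀) : Cmd.colorFinal.run v₀ S 17 v₀ v₀ := by
  simp [Cmd.colorFinal, Cmd.run, Fml.Holds, Fml.holds_or, Cmd.env, h]

open Classical in
-- Negative answers (an odd closed walk, a `K₄`, no guess) are each shown to exclude a 3-coloring.
-- For a coloring, the reductions of the machine are an actual run, and the painted coloring is one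
-- that `Finish` admits.
theorem algorithm_spec {G : SimpleGraph (Fin n)} (hi : IsIrreducible G) (hG : TwoConnecting G)
    (ha : IsArticulationNbhd G v₀) {m : Memory} {T : Rels n}
    (hT : T = Cmd.algorithm.run v₀ (inputRels G)) (h0 : m.reg 0 = if T 17 v₀ v₀ then 0 else 1)
    (h1 : ∀ v : Fin n, m.arr 1 v 0 = (if T 18 v v then 1 else 0) + 2 * if T 19 v v then 1 else 0) :
    ∃ out, Shows m out ∧ Reached G v₀ (.halted out) := by
  have hnone : T 17 v₀ v₀ → ¬ G.Colorable 3 → ∃ out, Shows m out ∧ Reached G v₀ (.halted out) :=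
    fun h h3 => ⟨none, by rw [Shows, h0, if_pos h], reached_none_of_not_colorable hi hG ha h3⟩
  obtain ⟨h6, hmerge⟩ := mergeClasses_spec (v₀ := v₀) G rfl
  simp only [Cmd.algorithm, Cmd.run_seq] at hT
  by_cases hc : (outside G v₀).Colorable 2
  swap
  · refine hnone ?_ (not_colorable_of_not_colorable_outside hi hG ha hc)
    rw [hT]
    refine run_colorFinal_of_six ?_
    rw [six_run_iter_reduceFirst, h6]
    exact hc
  obtain ⟨c, f, hf, hrep⟩ := hmerge hc
  have h₀ := hf.invariant hi hG ha
  obtain ⟨s, hs, hred, hinv, hno⟩ := run_iter_reduceFirst (v₀ := v₀) hrep h₀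
  set B : Set (Fin n) := {x | (∃ p, (s.Guess p ∧ ∀ p', s.Guess p' → p ≤ p') ∧ x ∈ s.blueOf p) ∨
      (¬ ∃ x, x ∈ s.rest) ∧ x ∈ s.blueOfNoRest} with hB
  obtain ⟨h17, h18, h19⟩ := hs.colorFinal hT (B := B) fun x => Iff.rfl
  rw [six_run_iter_reduceFirst, h6] at h17
  by_cases hK : s.graph.CliqueFree 4
  swap
  · exact hnone (h17.2 (Or.inr (Or.inl hK))) (hinv.not_colorable hK)
  have hF : s.IsFinal G := ⟨hinv, hK, hno⟩
  have hsome : ((∃ x, x ∈ s.rest) → ∃ p, s.Guess p) → Finish s (some (s.paint B)) →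
      ∃ out, Shows m out ∧ Reached G v₀ (.halted out) := by
    intro hp hfin
    have hloop := reached_of_reduce h₀ (.tail .refl (.merge c f hf)) hred hK
    refine ⟨some (s.paint B ∘ s.rep), ⟨?_, fun v => ?_⟩,
      hloop.tail (.finish s hK (fun ⟨s', hs'⟩ => ?_) _ hfin)⟩
    · rw [h0, if_neg]
      rw [h17]
      tauto
    · rw [h1, h18, h19]
      by_cases hv : s.rep v ∈ B
      · simp [hv, State.paint, Color.code]
      · by_cases hv' : s.rep v ∈ s.nbhd <;> simp [hv, hv', State.paint, Color.code]
    · obtain ⟨a, b, hab, -⟩ := (reduce_iff hinv.adjMem).1 hs'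
      exact hno a b hab
  by_cases hR : ∃ x, x ∈ s.rest
  · by_cases hp : ∃ p, s.Guess p
    · obtain ⟨p, hp', hmin⟩ := Set.exists_min_image {p | s.Guess p} id (Set.toFinite _) hp
      have hBp : B = s.blueOf p := by
        ext x
        constructor
        · rintro (⟨p', ⟨h₁, h₂⟩, h₃⟩ | h)
          · rwa [show p = p' from le_antisymm (hmin p' h₁) (h₂ p hp')]
          · exact absurd hR h.1
        · exact fun hx => Or.inl ⟨p, ⟨hp', hmin⟩, hx⟩
      refine hsome (fun _ => hp) ?_
      rw [hBp]
      exact hF.finish_blueOf hp'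
    · refine hnone (h17.2 (Or.inr (Or.inr ⟨hR, hp⟩))) fun h3 => hp ?_
      obtain ⟨χ, hχ⟩ := hinv.good h3
      exact hF.exists_guess hχ hR
  · have hB' : B = s.blueOfNoRest := by
      ext x
      constructor
      · rintro (⟨p, ⟨hp, -⟩, -⟩ | h)
        · exact absurd ⟨p, hp.1⟩ hR
        · exact h.2
      · exact fun hx => Or.inr ⟨hR, hx⟩
    refine hsome (fun h => absurd h hR) ?_
    rw [hB']
    exact hF.finish_blueOfNoRest (Set.not_nonempty_iff_eq_empty.1 hR)

end Algorithm

end ThreeCol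

theorem mainTheorem11 :
    ∃ (P : ThreeCol.Program) (p : Polynomial ℕ),
      ∀ (n : ℕ) (G : SimpleGraph (Fin n)) (v₀ : Fin n),
        ThreeCol.IsIrreducible G → G.diam = 2 → ThreeCol.IsArticulationNbhd G v₀ →
        -- every run of the algorithm, whatever its choices, ends after polynomially many transitions
        (∀ (l : ℕ) (run : ℕ → ThreeCol.Config (Fin n)), run 0 = ThreeCol.Config.start →
          (∀ i < l, ThreeCol.Step G v₀ (run i) (run (i + 1))) → l ≤ p.eval n) ∧
        -- no run gets stuck before it has produced an output
        (∀ c, ThreeCol.Reached G v₀ c →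
          (∃ out, c = ThreeCol.Config.halted out) ∨ ∃ c', ThreeCol.Step G v₀ c c') ∧
        -- every output is correct
        (∀ out, ThreeCol.Reached G v₀ (ThreeCol.Config.halted out) → ThreeCol.IsCorrect G out) ∧
        -- the machine program `P` carries out the algorithm in polynomial time
        (∃ (out : Option (Fin n → ThreeCol.Color)) (m : ThreeCol.Memory) (t : ℕ),
          ThreeCol.Exec P (ThreeCol.inputMemory G v₀) m t ∧ t ≤ p.eval n ∧
          ThreeCol.Shows m out ∧ ThreeCol.Reached G v₀ (ThreeCol.Config.halted out)) := by
  obtain ⟨P, p, hP⟩ := ThreeCol.exists_program .algorithm ThreeCol.Cmd.scoped_algorithm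
    (a := 18) (b := 19) (f := 17) (by omega) (by omega) (by omega)
  -- The summand `p` bounds the machine and `X + 2` the number of transitions.
  refine ⟨P, p + (Polynomial.X + 2), fun n G v₀ hi hd ha => ?_⟩
  have hG := ThreeCol.twoConnecting_of_diam_eq_two hd
  obtain ⟨m, t, hex, ht, h0, h1⟩ := hP n G v₀
  obtain ⟨out, hshow, hout⟩ := ThreeCol.algorithm_spec hi hG ha rfl h0 h1
  refine ⟨fun l run h0 hrun => ?_, fun c hc => ThreeCol.not_stuck hi hG ha hc,
    fun out hc => ThreeCol.sound_of_reached hi hG ha hc, out, m, t, hex, ?_, hshow, hout⟩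
  · have := ThreeCol.run_length_le hi hG ha h0 hrun
    rw [Nat.card_fin] at this
    simp only [Polynomial.eval_add, Polynomial.eval_X, Polynomial.eval_ofNat]
    omega
  · simp only [Polynomial.eval_add]
    omega
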